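/- Let $T$ be a complete first-order theory in a language $L$, let $|T| = |L| + \aleph_0$, and let $\mathfrak C$ be a monster model of $T$: a $\kappa$-saturated model of $T$ for some $\kappa > |T|$. Assume that $T$ is NIP: for every formula $\varphi(\bar x,\bar y)$ there is $n<\omega$ for which there are no $\bar y_0,\dots,\bar y_{n-1}$ in $\mathfrak C$ such that for every $\eta \in {}^n 2$ some $\bar x$ in $\mathfrak C$ satisfies $\varphi(\bar x,\bar y_i)$ exactly for those $i<n$ with $\eta(i)=1$. Let $M \prec \mathfrak C$ with $\|M\| < \kappa$, let $m<\omega$, and let $S^m(M)$ be the set of complete $m$-types over $M$. **Definitions.** * For an ultrafilter $D$ on ${}^mM$ and a set $B \subseteq \mathfrak C$, let $\mathrm{Av}(B,D)$ be the set of formulas $\psi(\bar x)$ over $B$ with $\{\bar d \in {}^mM : \mathfrak C \models \psi(\bar d)\} \in D$. For an infinite linear order $I$, a sequence $\bar{\mathbf b} = \langle \bar b_t : t\in I\rangle$ of $m$-tuples of $\mathfrak C$ is $D$-indiscernible over $M$ if $\mathrm{tp}(\bar b_t, M \cup \bigcup\{\bar b_s : s<t\}) = \mathrm{Av}(M\cup\bigcup\{\bar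 b_s : s<t\}, D)$ for every $t \in I$. Call $(D,\bar{\mathbf b})$ a pair for $p\in S^m(M)$ if $\mathrm{Av}(M,D) = p$ and $\bar{\mathbf b}$ is $D$-indiscernible over $M$. * $p \in S^m(M)$ is stable if there is a pair $(D,\bar{\mathbf b})$ for $p$ such that $\bar{\mathbf b}$ is an indiscernible set, i.e. for every $n$ all $n$-tuples of members of $\bar{\mathbf b}$ with distinct indices, in any order, have the same type over $\emptyset$. * $\mathfrak C^{eq}$ is the expansion of $\mathfrak C$ by all classes $\bar a/E$, for formulas $E(\bar x,\bar y)$ without parameters which define an equivalence relation on tuples of $\mathfrak C$ of some finite length, with a predicate for each sort and with the graphs of the maps $\bar a\mapsto \bar a/E$. * $\mathrm{avf}(\bar{\mathbf b})$ is the set of formulas $\varphi(\bar y,\bar z)$ with $\ell g(\bar y)=m$ such that for every $\bar c$ in $\mathfrak C$ the set of $t$ with $\varphi(\bar b_t,\bar c)$ or the set of $t$ with $\neg\varphi(\bar b_t,\bar c)$ is finite. For $\varphi\in\mathrm{avf}(\bar{\mathbf b})$ let $k$ be the least number such that for every $\bar c$ one of these two sets has fewer than $k/2$ members, let $E^k_\varphi(\bar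 x_0,\dots,\bar x_{k-1};\bar x_0',\dots,\bar x_{k-1}')$ say that for every $\bar z$, $\varphi(\bar x_i,\bar z)$ holds for more than $k/2$ of the $i<k$ if and only if $\varphi(\bar x'_i,\bar z)$ does, and let $Cb_\varphi(\bar{\mathbf b}) = (\bar b_{t_0},\dots,\bar b_{t_{k-1}})/E^k_\varphi \in \mathfrak C^{eq}$ for distinct $t_0,\dots,t_{k-1}\in I$. $Cb(\bar{\mathbf b})\subseteq\mathfrak C^{eq}$ is the definable closure of $\{Cb_\varphi(\bar{\mathbf b}) : \varphi\in \mathrm{avf}(\bar{\mathbf b})\}$. * $Cb(p)$ is the common value of $Cb(\bar{\mathbf b})$ for all pairs $(D,\bar{\mathbf b})$ for $p$. **Statement.** 1. If $p\in S^m(M)$ is stable, then $Cb(p)$ is well defined (there is a pair for $p$, and $Cb(\bar{\mathbf b})$ is the same for all pairs), and for every $L$-formula $\varphi(\bar y,\bar z)$ with $\ell g(\bar y)=m$, $p\restriction\varphi$ is definable: the set $\{\bar c \subseteq M : \varphi(\bar y,\bar c)\in p\}$ is definable in $M$ with parameters from $M$. In fact it is definable by parameters from $Cb(p)$: there is a formula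 $\theta(\bar z)$ in the language of $\mathfrak C^{eq}$ with parameters from $Cb(p)$ such that for all $\bar c\subseteq M$, $\varphi(\bar y,\bar c)\in p$ if and only if $\mathfrak C^{eq}\models\theta(\bar c)$. 2. The number of stable types $p\in S^m(M)$ is at most $\|M\|^{|T|}$. -/

import Mathlib

open FirstOrder Cardinal

universe u v w

namespace NIPTypes

section Basic

variable (L : FirstOrder.Language.{u, v})

/-- `|T|`: the number of formulas of the language, i.e. `|L| + ℵ₀`. -/
noncomputable def cardT : Cardinal.{max u v} := max ℵ₀ L.card

variable (C : Type w) [L.Structure C]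

/-- `C` is `κ`-saturated: every set of formulas in finitely many variables, with fewer than `κ`
parameters, which is finitely satisfiable in `C` is realized in `C`. -/
def IsSaturated (κ : Cardinal.{w}) : Prop :=
  ∀ A : Set C, #A < κ → ∀ (n : ℕ) (S : Set (L[[A]].Formula (Fin n))),
    (∀ F : Finset (L[[A]].Formula (Fin n)), (F : Set _) ⊆ S →
      ∃ v : Fin n → C, ∀ ψ ∈ F, ψ.Realize v) →
    ∃ v : Fin n → C, ∀ ψ ∈ S, ψ.Realize v

/-- `C` is a monster model of the complete theory `T`: a `κ`-saturated model of `T`, `κ > |T|`.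
The small sets and models are those of cardinality less than `κ`. (Strong homogeneity, which is
often required as well, is not needed; models with it are a special case.) -/
structure IsMonsterModel {L : FirstOrder.Language.{u, v}} (T : L.Theory) (C : Type w)
    [L.Structure C] (κ : Cardinal.{w}) : Prop where
  complete : T.IsComplete
  model : C ⊨ T
  card_lt : Cardinal.lift.{w} (cardT L) < Cardinal.lift.{max u v} κ
  saturated : IsSaturated L C κ

/-- No formula `φ(x̄, ȳ)` has the independence property in `C`. -/
def HasNIP : Prop :=
  ∀ (k l : ℕ) (φ : L.Formula (Fin k ⊕ Fin l)), ∃ n : ℕ,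
    ¬ ∃ y : Fin n → Fin l → C, ∀ η : Fin n → Bool, ∃ x : Fin k → C,
      ∀ i : Fin n, φ.Realize (Sum.elim x (y i)) ↔ η i = true

end Basic

section Types

variable {L : FirstOrder.Language.{u, v}} {C : Type w} [L.Structure C]

variable (L) in
/-- `S^m(A)`: the complete `m`-types over the set `A ⊆ C`, that is, the maximal sets of formulas
in `m` free variables and with parameters in `A` consistent with the theory of `(C, a)_{a ∈ A}`. -/
abbrev TypesOver (A : Set C) (m : ℕ) : Type (max u v w) :=
  (L[[A]].completeTheory C).CompleteType (Fin m)

/-- The formula `ψ(x̄)` over `A` belongs to the type `p`. -/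
def InType {A : Set C} {m : ℕ} (p : TypesOver L A m) (ψ : L[[A]].Formula (Fin m)) : Prop :=
  FirstOrder.Language.Formula.equivSentence ψ ∈ p

/-- `φ(x̄, c̄)`, where `φ(x̄, z̄)` has no parameters and `c̄` is a tuple from `A`. -/
def instParam {A : Set C} {m l : ℕ} (φ : L.Formula (Fin m ⊕ Fin l)) (c : Fin l → A) :
    L[[A]].Formula (Fin m) :=
  ((L.lhomWithConstants A).onFormula φ).subst
    (Sum.elim (fun i => FirstOrder.Language.Term.var i) (fun j => (L.con (c j)).term))

/-- `{c̄ ∈ ^l A : φ(x̄, c̄) ∈ p}`, the set which codes `p ↾ φ`. -/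
def restrictSet {A : Set C} {m l : ℕ} (p : TypesOver L A m) (φ : L.Formula (Fin m ⊕ Fin l)) :
    Set (Fin l → A) :=
  {c | InType p (instParam φ c)}

variable (L) in
/-- `Av(B, D)`, for an ultrafilter `D` on `^m M`. -/
def Av {M : Set C} {m : ℕ} (B : Set C) (D : Ultrafilter (Fin m → M)) :
    Set (L[[B]].Formula (Fin m)) :=
  {ψ | {d : Fin m → M | ψ.Realize (fun i => (d i : C))} ∈ D}

variable (L) in
/-- `b` is an `(M, D)`-indiscernible sequence: for every `t`, the type of `b t` over
`M ∪ ⋃ {b s : s < t}` is the `D`-average over that set. -/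
def IsDIndiscernible {M : Set C} {m : ℕ} (D : Ultrafilter (Fin m → M)) {I : Type w}
    [LinearOrder I] (b : I → Fin m → C) : Prop :=
  ∀ t : I, {ψ : L[[(M ∪ {x | ∃ s < t, ∃ j, b s j = x} : Set C)]].Formula (Fin m) |
      ψ.Realize (b t)} = Av L (M ∪ {x | ∃ s < t, ∃ j, b s j = x}) D

variable (L) in
/-- `b` is an indiscernible set (over `∅`): any two tuples of members with distinct indices,
in any order, satisfy the same formulas. -/
def IsIndiscernibleSet {m : ℕ} {I : Type w} (b : I → Fin m → C) : Prop :=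
  ∀ (n : ℕ) (s t : Fin n ↪ I) (φ : L.Formula (Fin n × Fin m)),
    φ.Realize (fun x => b (s x.1) x.2) ↔ φ.Realize (fun x => b (t x.1) x.2)

/-- `D` is an ultrafilter on `^m M` with `Av(M, D) = p`, and `b` is a `D`-indiscernible sequence
over `M`, indexed by an infinite linear order. -/
structure IsAverageSeq {M : Set C} {m : ℕ} (p : TypesOver L M m) (D : Ultrafilter (Fin m → M))
    {I : Type w} [LinearOrder I] (b : I → Fin m → C) : Prop where
  infinite : Infinite I
  av_eq : Av L M D = {ψ | InType p ψ}
  indisc : IsDIndiscernible L D b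

/-- The type `p` over `M` is stable. -/
def IsStableType {M : Set C} {m : ℕ} (p : TypesOver L M m) : Prop :=
  ∃ (D : Ultrafilter (Fin m → M)) (I : Type w) (_ : LinearOrder I) (b : I → Fin m → C),
    IsAverageSeq p D b ∧ IsIndiscernibleSet L b

end Types

section Imaginaries

/-- A formula `E(x̄, ȳ)` without parameters, `x̄` and `ȳ` of the same finite length, which defines
an equivalence relation on tuples of `C`. -/
structure EqFormula (L : FirstOrder.Language.{u, v}) (C : Type w) [L.Structure C] where
  arity : ℕ
  formula : L.Formula (Fin arity ⊕ Fin arity)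
  equiv : Equivalence (fun a b : Fin arity → C => formula.Realize (Sum.elim a b))

variable (L : FirstOrder.Language.{u, v}) (C : Type w) [L.Structure C]

variable {L C} in
/-- The equivalence relation defined by `E`. -/
def EqFormula.setoid (E : EqFormula L C) : Setoid (Fin E.arity → C) :=
  ⟨fun a b => E.formula.Realize (Sum.elim a b), E.equiv⟩

/-- The universe of `C^eq`: the elements of `C` and all classes `ā / E`. -/
inductive Ceq : Type (max u v w)
  | real (a : C) : Ceq
  | cls (E : EqFormula L C) (q : Quotient E.setoid) : Ceq

/-- The relation symbols of the language of `C^eq`: the symbols of `L` (the function symbols as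
their graphs), predicates for the real elements and for each sort of classes, and the graphs of the
projections `ā ↦ ā / E`. -/
inductive EqRel : ℕ → Type (max u v)
  | rel {n : ℕ} (R : L.Relations n) : EqRel n
  | graph {n : ℕ} (f : L.Functions n) : EqRel (n + 1)
  | home : EqRel 1
  | sort (E : EqFormula L C) : EqRel 1
  | proj (E : EqFormula L C) : EqRel (E.arity + 1)

/-- The language `L^eq`. -/
def Leq : FirstOrder.Language.{0, max u v} := ⟨fun _ => Empty, EqRel L C⟩

variable {L C} in
/-- The interpretation of the symbols of `L^eq` in `C^eq`. -/
def EqRel.Holds : {n : ℕ} → EqRel L C n → (Fin n → Ceq L C) → Prop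
  | _, .rel R, x => ∃ a : _ → C,
      x = (fun i => Ceq.real (a i)) ∧ FirstOrder.Language.Structure.RelMap R a
  | _, .graph f, x => ∃ a : _ → C,
      x = Fin.snoc (α := fun _ => Ceq L C) (fun i => Ceq.real (a i))
        (Ceq.real (FirstOrder.Language.Structure.funMap f a))
  | _, .home, x => ∃ a : C, x 0 = Ceq.real a
  | _, .sort E, x => ∃ q : Quotient E.setoid, x 0 = Ceq.cls E q
  | _, .proj E, x => ∃ a : Fin E.arity → C,
      x = Fin.snoc (α := fun _ => Ceq L C) (fun i => Ceq.real (a i))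
        (Ceq.cls E (Quotient.mk E.setoid a))

instance : (Leq L C).Structure (Ceq L C) where
  funMap f _ := nomatch f
  RelMap R x := EqRel.Holds R x

/-- The definable closure of `A` in a structure `N`. -/
def dcl (L' : FirstOrder.Language) {N : Type*} [L'.Structure N] (A : Set N) : Set N :=
  {e | A.Definable₁ L' {e}}

end Imaginaries

section CanonicalBase

variable {L : FirstOrder.Language.{u, v}}

/-- `⋁_{u ⊆ k, |u| > k/2} ⋀_{i ∈ u} φ(x̄_i, z̄)`. -/
noncomputable def majority {m l : ℕ} (φ : L.Formula (Fin m ⊕ Fin l)) (k : ℕ) :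
    L.Formula ((Fin k × Fin m) ⊕ Fin l) :=
  FirstOrder.Language.Formula.iSup fun s : {s : Finset (Fin k) // k < 2 * s.card} =>
    FirstOrder.Language.Formula.iInf fun i : s.1 => φ.relabel (Sum.map (fun j => (i.1, j)) id)

/-- The formula `E^k_φ(x̄_0, …, x̄_{k-1}; x̄'_0, …, x̄'_{k-1})`, which says that for all `z̄` the
majority of the `φ(x̄_i, z̄)` and the majority of the `φ(x̄'_i, z̄)` have the same truth value. The
`k` tuples of length `m` are concatenated to one tuple of length `k * m`. -/
noncomputable def majEqFormula {m l : ℕ} (φ : L.Formula (Fin m ⊕ Fin l)) (k : ℕ) :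
    L.Formula (Fin (k * m) ⊕ Fin (k * m)) :=
  FirstOrder.Language.Formula.iAlls (Fin l)
    (((majority φ k).relabel (Sum.map (fun x => Sum.inl (finProdFinEquiv x)) id)).iff
      ((majority φ k).relabel (Sum.map (fun x => Sum.inr (finProdFinEquiv x)) id)))

variable {C : Type w} [L.Structure C]

theorem realize_majEqFormula {m l : ℕ} (φ : L.Formula (Fin m ⊕ Fin l)) (k : ℕ)
    (a b : Fin (k * m) → C) :
    (majEqFormula φ k).Realize (Sum.elim a b) ↔ ∀ z : Fin l → C,
      ((majority φ k).Realize (Sum.elim (fun x => a (finProdFinEquiv x)) z) ↔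
        (majority φ k).Realize (Sum.elim (fun x => b (finProdFinEquiv x)) z)) := by
  simp only [majEqFormula, FirstOrder.Language.Formula.realize_iAlls,
    FirstOrder.Language.Formula.realize_iff, FirstOrder.Language.Formula.realize_relabel]
  refine forall_congr' fun z => iff_congr ?_ ?_ <;>
  · refine iff_of_eq (congrArg _ ?_)
    funext x
    cases x <;> rfl

variable (C) in
/-- `E^k_φ` as an index of a sort of `C^eq`. -/
noncomputable def majEq {m l : ℕ} (φ : L.Formula (Fin m ⊕ Fin l)) (k : ℕ) : EqFormula L C where
  arity := k * m
  formula := majEqFormula φ k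
  equiv := by
    simp only [realize_majEqFormula]
    exact ⟨fun _ _ => Iff.rfl, fun h z => (h z).symm, fun h h' z => (h z).trans (h' z)⟩

variable {m : ℕ} {I : Type w}

/-- `φ(ȳ, z̄) ∈ avf(b)`: every instance `φ(ȳ, c̄)` holds for only finitely many, or fails for only
finitely many, members of `b`. -/
def IsAveraging {l : ℕ} (φ : L.Formula (Fin m ⊕ Fin l)) (b : I → Fin m → C) : Prop :=
  ∀ c : Fin l → C, {t | φ.Realize (Sum.elim (b t) c)}.Finite ∨
    {t | ¬ φ.Realize (Sum.elim (b t) c)}.Finite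

/-- `k = k_φ(b)` is the least number such that every instance `φ(ȳ, c̄)` holds for fewer than `k/2`,
or fails for fewer than `k/2`, members of `b`. -/
def IsAvNumber {l : ℕ} (φ : L.Formula (Fin m ⊕ Fin l)) (b : I → Fin m → C) (k : ℕ) : Prop :=
  IsLeast {k : ℕ | ∀ c : Fin l → C, 2 * {t | φ.Realize (Sum.elim (b t) c)}.encard < k ∨
    2 * {t | ¬ φ.Realize (Sum.elim (b t) c)}.encard < k} k

variable (L) in
/-- `Cb(b)`: the definable closure in `C^eq` of the classes
`Cb_φ(b) = (b_{t_0}, …, b_{t_{k-1}}) / E^k_φ`, where `φ ∈ avf(b)`, `k = k_φ(b)` and the `t_i` are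
distinct. (For an indiscernible sequence the class does not depend on the `t_i`.) -/
def Cb (b : I → Fin m → C) : Set (Ceq L C) :=
  dcl (Leq L C) {e | ∃ (l : ℕ) (φ : L.Formula (Fin m ⊕ Fin l)) (k : ℕ) (t : Fin k ↪ I),
    IsAveraging φ b ∧ IsAvNumber φ b k ∧
      e = Ceq.cls (majEq C φ k) (Quotient.mk (majEq C φ k).setoid
        (fun x => b (t (finProdFinEquiv.symm x).1) (finProdFinEquiv.symm x).2))}

/-- `X = Cb(p)`: the common value of `Cb(b)` for all `D` and all `D`-indiscernible `b` over `M` such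
that `Av(M, D) = p`. -/
def IsCbOfType {M : Set C} {m : ℕ} (p : TypesOver L M m) (X : Set (Ceq L C)) : Prop :=
  (∃ (D : Ultrafilter (Fin m → M)) (I : Type w) (_ : LinearOrder I) (b : I → Fin m → C),
    IsAverageSeq p D b) ∧
  ∀ (D : Ultrafilter (Fin m → M)) (I : Type w) (_ : LinearOrder I) (b : I → Fin m → C),
    IsAverageSeq p D b → Cb L b = X

end CanonicalBase

end NIPTypes

open NIPTypes

namespace NIPTypes

/-! ### Global averages of ultrafilters and their Morley sequences. -/

section Average

open FirstOrder.Language Filter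

variable {L : FirstOrder.Language.{u, v}} {C : Type w} [L.Structure C] {m : ℕ}

/-! Push `D` forward to an ultrafilter `U` on tuples of `C` that concentrates on `M`. Its average
over all of `C` is a global type finitely satisfiable in `M`, and the `D`-indiscernible sequences
over `M` are its Morley sequences. Morley sequences of equal finite length have the same type over
`M` (`IsMorley.realize_congr`), so if one infinite Morley sequence is an indiscernible set, every
Morley sequence over `M` is totally indiscernible.

Let `n` bound the independent families of `φ`. If `φ(x̄, c̄)` is in the average, fewer than `n`
members of a Morley sequence fail it (`IsStableAverage.encard_not_lt`): otherwise continue `n`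
failing members by `n` that satisfy it. Total indiscernibility then lets suitable parameters cut out
every subset of a fixed `n`-tuple, contradicting NIP. Hence the majority of `2n` members decides the
`φ`-part of the average. By finite satisfiability these members can be replaced by tuples from `M`
(`IsStableAverage.exists_majority`). This gives definability over `M`, and also the count, since the
chosen tuples determine the type.

The average over `C` depends only on `p` (`IsStableAverage.eventually_of_agree`). So all pairs for
`p` give Morley sequences of one global type, and the canonical base, which codes the sets decided
by majorities, is the same for all. To define these sets inside `C^eq` from their codes, one must
express `L`-formulas on real elements in `L^eq`; `definable_real_fin` does so through an auxiliary
sort for each formula. -/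

theorem realize_constantsVars {B : Set C} {β : Type*} (ψ : L[[B]].Formula β) (v : β → C) :
    ψ.Realize v ↔ Formula.Realize (L := L) (α := B ⊕ β) (BoundedFormula.constantsVarsEquiv ψ)
      (Sum.elim Subtype.val v) := by
  have := @BoundedFormula.realize_constantsVarsEquiv L C _ B β _ _ 0 ψ v default
  exact this.symm

variable (L) in
/-- `x` realizes the average of the ultrafilter `U` over `B`. -/
def AvOver (U : Ultrafilter (Fin m → C)) (B : Set C) (x : Fin m → C) : Prop :=
  ∀ ψ : L.Formula (B ⊕ Fin m), ψ.Realize (Sum.elim Subtype.val x) ↔ ∀ᶠ d in U, ψ.Realize (Sum.elim Subtype.val d)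

variable (L) in
/-- A Morley sequence over `B` of the global type given by the ultrafilter `U`. -/
def IsMorley (U : Ultrafilter (Fin m → C)) (B : Set C) {I : Type*} [LinearOrder I]
    (b : I → Fin m → C) : Prop :=
  ∀ t, AvOver L U (B ∪ {x | ∃ s < t, ∃ j, b s j = x}) (b t)

theorem AvOver.realize_iff {U : Ultrafilter (Fin m → C)} {B : Set C} {x : Fin m → C}
    (h : AvOver L U B x) {α : Type*} (ψ : L.Formula (α ⊕ Fin m)) (c : α → C) (hc : ∀ a, c a ∈ B) :
    ψ.Realize (Sum.elim c x) ↔ ∀ᶠ d in U, ψ.Realize (Sum.elim c d) := by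
  have key : ∀ d : Fin m → C, (ψ.relabel (Sum.map (fun a => (⟨c a, hc a⟩ : B)) id)).Realize
      (Sum.elim Subtype.val d) ↔ ψ.Realize (Sum.elim c d) := by
    intro d
    rw [Formula.realize_relabel]
    refine iff_of_eq (congrArg _ ?_)
    funext y
    cases y <;> rfl
  simpa only [key] using h (ψ.relabel (Sum.map (fun a => (⟨c a, hc a⟩ : B)) id))

theorem AvOver.mono {U : Ultrafilter (Fin m → C)} {B B' : Set C} {x : Fin m → C}
    (h : AvOver L U B' x) (hB : B ⊆ B') : AvOver L U B x :=
  fun ψ => h.realize_iff ψ _ fun a => hB a.2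

theorem IsMorley.mono {U : Ultrafilter (Fin m → C)} {B B' : Set C} {I : Type*} [LinearOrder I]
    {b : I → Fin m → C} (h : IsMorley L U B' b) (hB : B ⊆ B') : IsMorley L U B b :=
  fun t => (h t).mono (Set.union_subset_union_left _ hB)

theorem IsMorley.comp {U : Ultrafilter (Fin m → C)} {B : Set C} {I J : Type*} [LinearOrder I]
    [LinearOrder J] {b : I → Fin m → C} (h : IsMorley L U B b) {f : J → I} (hf : StrictMono f) :
    IsMorley L U B (fun j => b (f j)) := by
  refine fun t => (h (f t)).mono (Set.union_subset_union_right _ ?_)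
  rintro x ⟨s, hs, j, rfl⟩
  exact ⟨f s, hf hs, j, rfl⟩

theorem IsMorley.sumLex {U : Ultrafilter (Fin m → C)} {A B : Set C} {I J : Type*} [LinearOrder I]
    [LinearOrder J] {a : I → Fin m → C} {b : J → Fin m → C} (ha : IsMorley L U A a)
    (hb : IsMorley L U B b) (hAB : A ⊆ B) (haB : ∀ i j, a i j ∈ B) :
    IsMorley L U A (fun t : I ⊕ₗ J => Sum.elim a b (ofLex t)) := by
  intro t
  induction t using Lex.rec with | h t => ?_
  rcases t with i | i
  · refine (ha i).mono (Set.union_subset_union_right _ ?_)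
    rintro x ⟨s, hs, j, rfl⟩
    induction s using Lex.rec with | h s => ?_
    rcases s with s | s
    · exact ⟨s, Sum.Lex.inl_lt_inl_iff.1 hs, j, rfl⟩
    · exact absurd hs Sum.Lex.not_inr_lt_inl
  · refine (hb i).mono ?_
    rintro x (hx | ⟨s, hs, j, rfl⟩)
    · exact Or.inl (hAB hx)
    induction s using Lex.rec with | h s => ?_
    rcases s with s | s
    · exact Or.inl (haB s j)
    · exact Or.inr ⟨s, Sum.Lex.inr_lt_inr_iff.1 hs, j, rfl⟩

/-- Separates the variables of the last of `n + 1` tuples. -/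
def splitLast {α : Type*} {n : ℕ} : α ⊕ (Fin (n + 1) × Fin m) → (α ⊕ (Fin n × Fin m)) ⊕ Fin m :=
  Sum.elim (fun a => Sum.inl (Sum.inl a)) fun x =>
    Fin.lastCases (motive := fun _ => (α ⊕ (Fin n × Fin m)) ⊕ Fin m) (Sum.inr x.2)
      (fun i => Sum.inl (Sum.inr (i, x.2))) x.1

theorem elim_comp_splitLast {α : Type*} {n : ℕ} (c : α → C) (a : Fin n → Fin m → C)
    (d : Fin m → C) :
    Sum.elim (Sum.elim c (fun x => a x.1 x.2)) d ∘ splitLast =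
      Sum.elim c (fun x => (Fin.snoc a d : Fin (n + 1) → Fin m → C) x.1 x.2) := by
  funext y
  rcases y with y | ⟨i, j⟩
  · rfl
  · induction i using Fin.lastCases with
    | last => simp [splitLast]
    | cast i => simp [splitLast]

theorem exists_formula_snoc {B : Set C} {n : ℕ} (ψ : L.Formula (B ⊕ (Fin (n + 1) × Fin m)))
    (d : Fin m → C) (hd : ∀ j, d j ∈ B) :
    ∃ χ : L.Formula (B ⊕ (Fin n × Fin m)), ∀ a : Fin n → Fin m → C,
      χ.Realize (Sum.elim Subtype.val fun x => a x.1 x.2) ↔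
        ψ.Realize (Sum.elim Subtype.val fun x => (Fin.snoc a d : Fin (n + 1) → Fin m → C) x.1 x.2) := by
  refine ⟨ψ.relabel (Sum.elim id (fun j => Sum.inl ⟨d j, hd j⟩) ∘ splitLast), fun a => ?_⟩
  rw [Formula.realize_relabel, ← Function.comp_assoc, ← elim_comp_splitLast]
  refine iff_of_eq (congrArg (fun f => ψ.Realize (f ∘ splitLast)) ?_)
  funext y
  cases y <;> rfl

theorem IsMorley.init {U : Ultrafilter (Fin m → C)} {B : Set C} {n : ℕ}
    {a : Fin (n + 1) → Fin m → C} (h : IsMorley L U B a) : IsMorley L U B (Fin.init a) :=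
  h.comp (Fin.strictMono_castSucc)

theorem IsMorley.realize_last {U : Ultrafilter (Fin m → C)} {B : Set C} {n : ℕ}
    {a : Fin (n + 1) → Fin m → C} (h : IsMorley L U B a) {α : Type*}
    (ψ : L.Formula (α ⊕ (Fin (n + 1) × Fin m))) (c : α → C) (hc : ∀ i, c i ∈ B) :
    ψ.Realize (Sum.elim c fun x => a x.1 x.2) ↔ ∀ᶠ d in U, ψ.Realize
      (Sum.elim c fun x => (Fin.snoc (Fin.init a) d : Fin (n + 1) → Fin m → C) x.1 x.2) := by
  have := (h (Fin.last n)).realize_iff (ψ.relabel splitLast)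
    (Sum.elim c fun x => Fin.init a x.1 x.2) (by
      rintro (i | ⟨i, j⟩)
      · exact Or.inl (hc i)
      · exact Or.inr ⟨i.castSucc, Fin.castSucc_lt_last i, j, rfl⟩)
  simpa only [Formula.realize_relabel, elim_comp_splitLast, Fin.snoc_init_self] using this

/-- The last member may be replaced by a `U`-typical `d`. As `U` concentrates on `M`, this `d`
becomes a parameter from `M`, and the induction stays over `M`. -/
theorem IsMorley.realize_congr {U : Ultrafilter (Fin m → C)} {M : Set C}
    (hU : ∀ᶠ d : Fin m → C in U, ∀ j, d j ∈ M) : ∀ {n : ℕ} {a a' : Fin n → Fin m → C}, IsMorley L U M a →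
      IsMorley L U M a' → ∀ ψ : L.Formula (M ⊕ (Fin n × Fin m)),
        ψ.Realize (Sum.elim Subtype.val fun x => a x.1 x.2) ↔ ψ.Realize (Sum.elim Subtype.val fun x => a' x.1 x.2)
  | 0, a, a', _, _, ψ => by rw [Subsingleton.elim a a']
  | n + 1, a, a', h, h', ψ => by
    rw [h.realize_last ψ _ fun i => i.2, h'.realize_last ψ _ fun i => i.2]
    refine eventually_congr (hU.mono fun d hd => ?_)
    obtain ⟨χ, hχ⟩ := exists_formula_snoc ψ d hd
    rw [← hχ, ← hχ]
    exact h.init.realize_congr hU h'.init χ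

/-- Finite satisfiability in `M` for whole sequences: the last member is pulled into `M` first, and
then serves as a parameter for the earlier ones. -/
theorem IsMorley.exists_realize_mem {U : Ultrafilter (Fin m → C)} {M B : Set C} (hMB : M ⊆ B)
    (hU : ∀ᶠ d : Fin m → C in U, ∀ j, d j ∈ M) : ∀ {n : ℕ} {a : Fin n → Fin m → C}, IsMorley L U B a →
      ∀ ψ : L.Formula (B ⊕ (Fin n × Fin m)), ψ.Realize (Sum.elim Subtype.val fun x => a x.1 x.2) →
        ∃ d : Fin n → Fin m → C, (∀ i j, d i j ∈ M) ∧ ψ.Realize (Sum.elim Subtype.val fun x => d x.1 x.2)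
  | 0, a, _, ψ, hψ => ⟨a, fun i => i.elim0, hψ⟩
  | n + 1, a, h, ψ, hψ => by
    obtain ⟨d, hdM, hd⟩ := (hU.and ((h.realize_last ψ _ fun i => i.2).1 hψ)).exists
    obtain ⟨χ, hχ⟩ := exists_formula_snoc ψ d fun j => hMB (hdM j)
    obtain ⟨e, heM, he⟩ := h.init.exists_realize_mem hMB hU χ ((hχ _).2 hd)
    refine ⟨Fin.snoc e d, fun i j => ?_, (hχ e).1 he⟩
    induction i using Fin.lastCases with
    | last => simpa using hdM j
    | cast i => simpa using heM i j

theorem IsSaturated.exists_avOver {κ : Cardinal.{w}} (hC : IsSaturated L C κ)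
    (U : Ultrafilter (Fin m → C)) (B : Set C) (hB : #B < κ) : ∃ x, AvOver L U B x := by
  obtain ⟨x, hx⟩ := hC B hB m {ψ | ∀ᶠ d : Fin m → C in U, ψ.Realize d} fun F hF => by
    have : ∀ᶠ d : Fin m → C in U, ∀ ψ ∈ F, ψ.Realize d := by
      rw [Filter.eventually_all_finset]
      exact fun ψ hψ => hF hψ
    exact this.exists
  have key : ∀ ψ : L.Formula (B ⊕ Fin m), (∀ᶠ d in U, ψ.Realize (Sum.elim Subtype.val d)) →
      ψ.Realize (Sum.elim Subtype.val x) := by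
    intro ψ hψ
    obtain ⟨χ, rfl⟩ := BoundedFormula.constantsVarsEquiv.surjective ψ
    rw [← realize_constantsVars χ x]
    exact hx χ (hψ.mono fun d hd => (realize_constantsVars χ d).2 hd)
  refine ⟨x, fun ψ => ⟨fun h => ?_, key ψ⟩⟩
  by_contra hn
  exact key ψ.not (by simpa only [Formula.realize_not] using Ultrafilter.eventually_not.2 hn) h

theorem mk_union_range_lt {κ : Cardinal.{w}} (hκ : ℵ₀ ≤ κ) {B : Set C} (hB : #B < κ)
    {ι : Type*} [Finite ι] (f : ι → C) : #(B ∪ Set.range f : Set C) < κ :=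
  (mk_union_le _ _).trans_lt (add_lt_of_lt hκ hB
    ((lt_aleph0_iff_set_finite.2 (Set.finite_range f)).trans_le hκ))

theorem IsSaturated.exists_isMorley {κ : Cardinal.{w}} (hC : IsSaturated L C κ) (hκ : ℵ₀ ≤ κ)
    (U : Ultrafilter (Fin m → C)) (B : Set C) (hB : #B < κ) (n : ℕ) :
    ∃ a : Fin n → Fin m → C, IsMorley L U B a := by
  induction n with
  | zero => exact ⟨Fin.elim0, fun t => t.elim0⟩
  | succ n ih =>
    obtain ⟨a, ha⟩ := ih
    obtain ⟨x, hx⟩ := hC.exists_avOver U _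
      (mk_union_range_lt hκ hB fun y : Fin n × Fin m => a y.1 y.2)
    refine ⟨Fin.snoc a x, fun t => ?_⟩
    induction t using Fin.lastCases with
    | last =>
      rw [Fin.snoc_last]
      refine hx.mono (Set.union_subset_union_right _ ?_)
      rintro _ ⟨s, hs, j, rfl⟩
      obtain ⟨s, rfl⟩ := Fin.exists_castSucc_eq.2 hs.ne
      exact ⟨(s, j), by simp⟩
    | cast t =>
      rw [Fin.snoc_castSucc]
      refine (ha t).mono (Set.union_subset_union_right _ ?_)
      rintro _ ⟨s, hs, j, rfl⟩
      obtain ⟨s, rfl⟩ := Fin.exists_castSucc_eq.2 (hs.trans (Fin.castSucc_lt_last t)).ne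
      exact ⟨s, Fin.castSucc_lt_castSucc_iff.1 hs, j, by simp⟩

end Average

/-! ### NIP and totally indiscernible Morley sequences: majorities, definability, uniqueness of the
average. -/

section Stable

open FirstOrder.Language Filter

variable {L : FirstOrder.Language.{u, v}} {C : Type w} [L.Structure C] {m : ℕ}

theorem elim_comp_swap {α β γ : Type*} (f : α → γ) (g : β → γ) :
    Sum.elim f g ∘ Sum.swap = Sum.elim g f := by
  funext y
  cases y <;> rfl

theorem AvOver.realize_iff' {U : Ultrafilter (Fin m → C)} {B : Set C} {x : Fin m → C}
    (h : AvOver L U B x) {α : Type*} (ψ : L.Formula (Fin m ⊕ α)) (c : α → C) (hc : ∀ a, c a ∈ B) :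
    ψ.Realize (Sum.elim x c) ↔ ∀ᶠ d in U, ψ.Realize (Sum.elim d c) := by
  simpa only [Formula.realize_relabel, elim_comp_swap] using
    h.realize_iff (ψ.relabel Sum.swap) c hc

theorem exists_formula_fin {α : Type*} (ψ : L.Formula (Fin m ⊕ α)) :
    ∃ (l : ℕ) (φ : L.Formula (Fin m ⊕ Fin l)) (e : Fin l → α), ∀ (x : Fin m → C) (c : α → C),
      ψ.Realize (Sum.elim x c) ↔ φ.Realize (Sum.elim x (c ∘ e)) := by
  classical
  let S : Finset α := ψ.freeVarFinset.toRight
  let f : ψ.freeVarFinset → Fin m ⊕ Fin S.card := fun y => match y with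
    | ⟨Sum.inl j, _⟩ => Sum.inl j
    | ⟨Sum.inr a, ha⟩ => Sum.inr (S.equivFin ⟨a, Finset.mem_toRight.2 ha⟩)
  refine ⟨S.card, BoundedFormula.restrictFreeVar ψ f, fun i => S.equivFin.symm i, fun x c => ?_⟩
  refine (BoundedFormula.realize_restrictFreeVar _ ?_).symm
  rintro ⟨j | a, ha⟩ <;> simp [f]

/-- There is no independent family of `n` instances `φ(y_i, z)`. -/
def NoPatterns (C : Type w) [L.Structure C] {l : ℕ} (φ : L.Formula (Fin m ⊕ Fin l)) (n : ℕ) :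
    Prop :=
  ¬ ∃ y : Fin n → Fin m → C, ∀ η : Fin n → Bool, ∃ z : Fin l → C,
    ∀ i, φ.Realize (Sum.elim (y i) z) ↔ η i = true

theorem HasNIP.exists_noPatterns (h : HasNIP L C) {l : ℕ} (φ : L.Formula (Fin m ⊕ Fin l)) :
    ∃ n, NoPatterns C φ n := by
  obtain ⟨n, hn⟩ := h l m (φ.relabel Sum.swap)
  refine ⟨n, fun ⟨y, hy⟩ => hn ⟨y, fun η => ?_⟩⟩
  simpa only [Formula.realize_relabel, elim_comp_swap] using hy η

theorem NoPatterns.not {l : ℕ} {φ : L.Formula (Fin m ⊕ Fin l)} {n : ℕ} (h : NoPatterns C φ n) :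
    NoPatterns C φ.not n := by
  rintro ⟨y, hy⟩
  refine h ⟨y, fun η => ?_⟩
  obtain ⟨z, hz⟩ := hy fun i => !η i
  refine ⟨z, fun i => ?_⟩
  have := hz i
  rw [Formula.realize_not] at this
  rw [← not_iff_not, this]
  cases η i <;> simp

variable (L) in
/-- `U` is an ultrafilter on `M` whose Morley sequences over `M` are indiscernible sets, in a model
with enough saturation to have such sequences. -/
structure IsStableAverage (U : Ultrafilter (Fin m → C)) (M : Set C) : Prop where
  mem : ∀ᶠ d : Fin m → C in U, ∀ j, d j ∈ M
  exists_isMorley : ∀ F : Set C, F.Finite → ∀ n, ∃ a : Fin n → Fin m → C, IsMorley L U (M ∪ F) a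
  perm : ∀ (n : ℕ) (a : Fin n → Fin m → C), IsMorley L U M a → ∀ (σ : Equiv.Perm (Fin n))
    (ψ : L.Formula (Fin n × Fin m)),
      ψ.Realize (fun x => a (σ x.1) x.2) ↔ ψ.Realize (fun x => a x.1 x.2)

theorem IsMorley.realize_congr' {U : Ultrafilter (Fin m → C)} {M : Set C}
    (hU : ∀ᶠ d : Fin m → C in U, ∀ j, d j ∈ M) {n : ℕ} {a a' : Fin n → Fin m → C}
    (ha : IsMorley L U M a) (ha' : IsMorley L U M a') (ψ : L.Formula (Fin n × Fin m)) :
    ψ.Realize (fun x => a x.1 x.2) ↔ ψ.Realize (fun x => a' x.1 x.2) := by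
  simpa only [Formula.realize_relabel, Sum.elim_comp_inr] using
    ha.realize_congr hU ha' (ψ.relabel Sum.inr)

variable {U : Ultrafilter (Fin m → C)} {M : Set C}

theorem IsStableAverage.realize_iff (h : IsStableAverage L U M) {J : Type*} [LinearOrder J]
    {b : J → Fin m → C} (hb : IsMorley L U M b) {n : ℕ} (s : Fin n ↪ J) {a : Fin n → Fin m → C}
    (ha : IsMorley L U M a) (ψ : L.Formula (Fin n × Fin m)) :
    ψ.Realize (fun x => b (s x.1) x.2) ↔ ψ.Realize (fun x => a x.1 x.2) := by
  -- Sorting the indices gives a subsequence in increasing order, which is again Morley; total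
  -- indiscernibility undoes the sorting.
  have hmono : StrictMono (s ∘ Tuple.sort s) :=
    (Tuple.monotone_sort s).strictMono_of_injective (s.injective.comp (Equiv.injective _))
  have h1 := h.perm n _ (hb.comp hmono) (Tuple.sort s).symm ψ
  simp only [Function.comp_apply, Equiv.apply_symm_apply] at h1
  exact h1.trans ((hb.comp hmono).realize_congr' h.mem ha ψ)

/-- The existence of a parameter with a given truth pattern is a parameter-free property of the
tuples, so it does not depend on the Morley sequence or on the order of the chosen members. -/
theorem IsStableAverage.exists_pattern (h : IsStableAverage L U M) {l n : ℕ}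
    (φ : L.Formula (Fin m ⊕ Fin l)) {J : Type*} [LinearOrder J] {b : J → Fin m → C}
    (hb : IsMorley L U M b) (t : Fin n ↪ J) {a : Fin n → Fin m → C} (ha : IsMorley L U M a)
    (η : Fin n → Prop) : (∃ c : Fin l → C, ∀ i, φ.Realize (Sum.elim (b (t i)) c) ↔ η i) ↔
      ∃ c : Fin l → C, ∀ i, φ.Realize (Sum.elim (a i) c) ↔ η i := by
  classical
  let θ : Fin n → L.Formula ((Fin n × Fin m) ⊕ Fin l) := fun i =>
    φ.relabel (Sum.map (fun j => (i, j)) id)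
  have hθ : ∀ (i : Fin n) (y : Fin n → Fin m → C) (z : Fin l → C), (θ i).Realize
      (Sum.elim (fun x => y x.1 x.2) z) ↔ φ.Realize (Sum.elim (y i) z) := by
    intro i y z
    rw [Formula.realize_relabel]
    refine iff_of_eq (congrArg _ ?_)
    funext x
    cases x <;> rfl
  let χ : L.Formula (Fin n × Fin m) := Formula.iExs (Fin l) (Formula.iInf fun i : Fin n =>
    if η i then θ i else (θ i).not)
  have hχ : ∀ y : Fin n → Fin m → C, χ.Realize (fun x => y x.1 x.2) ↔
      ∃ z : Fin l → C, ∀ i, φ.Realize (Sum.elim (y i) z) ↔ η i := by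
    intro y
    simp only [χ, Formula.realize_iExs, Formula.realize_iInf]
    refine exists_congr fun z => forall_congr' fun i => ?_
    by_cases hi : η i <;> simp [hi, hθ]
  exact (hχ fun i => b (t i)).symm.trans ((h.realize_iff hb t ha χ).trans (hχ a))

theorem IsStableAverage.not_both (h : IsStableAverage L U M) {l n : ℕ}
    {φ : L.Formula (Fin m ⊕ Fin l)} (hn : NoPatterns C φ n) {J : Type*} [LinearOrder J]
    {b : J → Fin m → C} (hb : IsMorley L U M b) (c : Fin l → C) (s s' : Fin n ↪ J)
    (hs : ∀ i, φ.Realize (Sum.elim (b (s i)) c)) (hs' : ∀ i, ¬ φ.Realize (Sum.elim (b (s' i)) c)) :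
    False := by
  obtain ⟨a, ha⟩ := h.exists_isMorley ∅ Set.finite_empty n
  rw [Set.union_empty] at ha
  refine hn ⟨a, fun η => ?_⟩
  -- For each `η`, members satisfying and failing the instance at `c` are mixed to show the pattern
  -- `η`; it is then transferred to the one tuple `a`, fixed for all `η`.
  let t : Fin n ↪ J := ⟨fun i => if η i then s i else s' i, by
    intro i j hij
    have hss : ∀ i j, s i ≠ s' j := fun i j hij => hs' j (hij ▸ hs i)
    by_cases hi : η i <;> by_cases hj : η j <;>
      simp only [hi, hj, if_true, Bool.false_eq_true, if_false] at hij
    · exact s.injective hij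
    · exact absurd hij (hss i j)
    · exact absurd hij.symm (hss j i)
    · exact s'.injective hij⟩
  refine (h.exists_pattern φ hb t ha fun i => η i = true).1 ⟨c, fun i => ?_⟩
  by_cases hi : η i
  · have : t i = s i := if_pos hi
    simpa [this, hi] using hs i
  · have : t i = s' i := if_neg hi
    simpa [this, hi] using hs' i

theorem exists_strictMono_of_le_encard {J : Type*} [LinearOrder J] {S : Set J} {n : ℕ}
    (h : (n : ℕ∞) ≤ S.encard) : ∃ f : Fin n → J, StrictMono f ∧ ∀ i, f i ∈ S := by
  obtain ⟨t, htS, ht⟩ := Set.exists_subset_encard_eq h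
  have hfin : t.Finite := Set.finite_of_encard_eq_coe ht
  have hcard : hfin.toFinset.card = n := by
    rw [hfin.encard_eq_coe_toFinset_card] at ht
    exact_mod_cast ht
  refine ⟨hfin.toFinset.orderEmbOfFin hcard, OrderEmbedding.strictMono _, fun i => htS ?_⟩
  exact hfin.mem_toFinset.1 (hfin.toFinset.orderEmbOfFin_mem hcard i)

/-- A Morley sequence over `M`, the `n` exceptional members and `c` consists of realizations of
`φ(x̄, c)`. Appended to those members, it gives the configuration excluded by `not_both`. -/
theorem IsStableAverage.encard_not_lt (h : IsStableAverage L U M) {l n : ℕ}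
    {φ : L.Formula (Fin m ⊕ Fin l)} (hn : NoPatterns C φ n) {J : Type*} [LinearOrder J]
    {b : J → Fin m → C} (hb : IsMorley L U M b) (c : Fin l → C)
    (hc : ∀ᶠ d in U, φ.Realize (Sum.elim d c)) :
    {t | ¬ φ.Realize (Sum.elim (b t) c)}.encard < n := by
  by_contra hlt
  obtain ⟨f, hf, hfS⟩ := exists_strictMono_of_le_encard (not_lt.1 hlt)
  obtain ⟨a, ha⟩ := h.exists_isMorley (Set.range fun y : (Fin n × Fin m) ⊕ Fin l =>
    Sum.elim (fun x => b (f x.1) x.2) c y) (Set.finite_range _) n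
  have hcat := (hb.comp hf).sumLex ha Set.subset_union_left
    fun i j => Or.inr ⟨Sum.inl (i, j), rfl⟩
  refine h.not_both hn hcat c ⟨fun i => toLex (Sum.inr i), fun i j hij => by simpa using hij⟩
    ⟨fun i => toLex (Sum.inl i), fun i j hij => by simpa using hij⟩ (fun i => ?_) fun i => hfS i
  exact ((ha i).realize_iff' φ c fun j => Or.inl (Or.inr ⟨Sum.inr j, rfl⟩)).2 hc

theorem IsStableAverage.encard_lt (h : IsStableAverage L U M) {l n : ℕ}
    {φ : L.Formula (Fin m ⊕ Fin l)} (hn : NoPatterns C φ n) {J : Type*} [LinearOrder J]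
    {b : J → Fin m → C} (hb : IsMorley L U M b) (c : Fin l → C)
    (hc : ¬ ∀ᶠ d in U, φ.Realize (Sum.elim d c)) :
    {t | φ.Realize (Sum.elim (b t) c)}.encard < n := by
  rw [← Ultrafilter.eventually_not] at hc
  simpa only [Formula.realize_not, not_not] using h.encard_not_lt hn.not hb c hc

theorem realize_majority {l : ℕ} (φ : L.Formula (Fin m ⊕ Fin l)) (k : ℕ) (x : Fin k → Fin m → C)
    (z : Fin l → C) : (majority φ k).Realize (Sum.elim (fun y => x y.1 y.2) z) ↔
      ∃ s : Finset (Fin k), k < 2 * s.card ∧ ∀ i ∈ s, φ.Realize (Sum.elim (x i) z) := by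
  have hθ : ∀ i : Fin k, (φ.relabel (Sum.map (fun j => (i, j)) id)).Realize
      (Sum.elim (fun y => x y.1 y.2) z) ↔ φ.Realize (Sum.elim (x i) z) := by
    intro i
    rw [Formula.realize_relabel]
    refine iff_of_eq (congrArg _ ?_)
    funext y
    cases y <;> rfl
  simp only [majority, Formula.realize_iSup, Formula.realize_iInf, hθ]
  exact ⟨fun ⟨s, hs⟩ => ⟨s.1, s.2, fun i hi => hs ⟨i, hi⟩⟩,
    fun ⟨s, hs, hs'⟩ => ⟨⟨s, hs⟩, fun i => hs' i.1 i.2⟩⟩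

theorem majority_of_encard_not_lt {k : ℕ} {P : Fin k → Prop}
    (h : 2 * {i | ¬ P i}.encard < k) : ∃ s : Finset (Fin k), k < 2 * s.card ∧ ∀ i ∈ s, P i := by
  classical
  refine ⟨Finset.univ.filter P, ?_, fun i hi => by simpa using hi⟩
  have h1 : {i | ¬ P i} = ((Finset.univ.filter fun i => ¬ P i : Finset (Fin k)) : Set (Fin k)) := by
    ext
    simp
  rw [h1, Set.encard_coe_eq_coe_finsetCard] at h
  have h2 : 2 * (Finset.univ.filter fun i => ¬ P i).card < k := by exact_mod_cast h
  have h3 := Finset.card_filter_add_card_filter_not (s := (Finset.univ : Finset (Fin k))) P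
  rw [Finset.card_univ, Fintype.card_fin] at h3
  omega

theorem not_majority_of_encard_lt {k : ℕ} {P : Fin k → Prop}
    (h : 2 * {i | P i}.encard < k) : ¬ ∃ s : Finset (Fin k), k < 2 * s.card ∧ ∀ i ∈ s, P i := by
  rintro ⟨s, hs, hP⟩
  have h1 : (s : Set (Fin k)).encard ≤ {i | P i}.encard := Set.encard_le_encard hP
  rw [Set.encard_coe_eq_coe_finsetCard] at h1
  have h2 : (2 : ℕ∞) * s.card < k := (mul_le_mul_right h1 2).trans_lt h
  have h3 : 2 * s.card < k := by exact_mod_cast h2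
  omega

theorem two_mul_encard_lt {J : Type*} {S : Set J} {n : ℕ} (h : S.encard < n) :
    2 * S.encard < (2 * n : ℕ) := by
  lift S.encard to ℕ using (h.trans_le le_top).ne with k
  have : k < n := by exact_mod_cast h
  exact_mod_cast (by omega : 2 * k < 2 * n)

theorem IsStableAverage.majority_iff (h : IsStableAverage L U M) {l n : ℕ}
    {φ : L.Formula (Fin m ⊕ Fin l)} (hn : NoPatterns C φ n) {a : Fin (2 * n) → Fin m → C}
    (ha : IsMorley L U M a) (c : Fin l → C) :
    (majority φ (2 * n)).Realize (Sum.elim (fun y => a y.1 y.2) c) ↔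
      ∀ᶠ d in U, φ.Realize (Sum.elim d c) := by
  rw [realize_majority]
  by_cases hc : ∀ᶠ d in U, φ.Realize (Sum.elim d c)
  · exact iff_of_true (majority_of_encard_not_lt (two_mul_encard_lt (h.encard_not_lt hn ha c hc))) hc
  · exact iff_of_false (not_majority_of_encard_lt (two_mul_encard_lt (h.encard_lt hn ha c hc))) hc

/-- For a Morley sequence `y` over `M` and another Morley sequence `x`, both majorities define the
average. Their equivalence is a formula about `y` with parameters `x`, so it is also satisfied by
tuples from `M`. -/
theorem IsStableAverage.exists_majority (h : IsStableAverage L U M) {l n : ℕ}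
    {φ : L.Formula (Fin m ⊕ Fin l)} (hn : NoPatterns C φ n) :
    ∃ a : Fin (2 * n) → Fin m → C, (∀ i j, a i j ∈ M) ∧ ∀ c : Fin l → C,
      (majority φ (2 * n)).Realize (Sum.elim (fun y => a y.1 y.2) c) ↔
        ∀ᶠ d in U, φ.Realize (Sum.elim d c) := by
  obtain ⟨x, hx⟩ := h.exists_isMorley ∅ Set.finite_empty (2 * n)
  rw [Set.union_empty] at hx
  obtain ⟨y, hy⟩ := h.exists_isMorley (Set.range fun p : Fin (2 * n) × Fin m => x p.1 p.2)
    (Set.finite_range _) (2 * n)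
  let B := M ∪ Set.range fun p : Fin (2 * n) × Fin m => x p.1 p.2
  let χ : L.Formula (B ⊕ (Fin (2 * n) × Fin m)) := Formula.iAlls (Fin l)
    (((majority φ (2 * n)).relabel (Sum.elim (fun p => Sum.inl (Sum.inr p)) Sum.inr)).iff
      ((majority φ (2 * n)).relabel
        (Sum.elim (fun p => Sum.inl (Sum.inl ⟨x p.1 p.2, Or.inr ⟨p, rfl⟩⟩)) Sum.inr)))
  have hχ : ∀ a : Fin (2 * n) → Fin m → C, χ.Realize (Sum.elim Subtype.val fun p => a p.1 p.2) ↔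
      ∀ c : Fin l → C, (majority φ (2 * n)).Realize (Sum.elim (fun p => a p.1 p.2) c) ↔
        (majority φ (2 * n)).Realize (Sum.elim (fun p => x p.1 p.2) c) := by
    intro a
    simp only [χ, Formula.realize_iAlls, Formula.realize_iff, Formula.realize_relabel]
    refine forall_congr' fun c => iff_congr ?_ ?_ <;>
    · refine iff_of_eq (congrArg _ ?_)
      funext p
      cases p <;> rfl
  obtain ⟨d, hdM, hd⟩ := hy.exists_realize_mem Set.subset_union_left h.mem χ ((hχ y).2 fun c => by
    rw [h.majority_iff hn hx, h.majority_iff hn (hy.mono Set.subset_union_left)])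
  exact ⟨d, hdM, fun c => ((hχ d).1 hd c).trans (h.majority_iff hn hx c)⟩

theorem IsStableAverage.exists_definition (h : IsStableAverage L U M) (hNIP : HasNIP L C)
    {α : Type*} (ψ : L.Formula (Fin m ⊕ α)) :
    ∃ δ : L.Formula (M ⊕ α), ∀ c : α → C,
      δ.Realize (Sum.elim Subtype.val c) ↔ ∀ᶠ d in U, ψ.Realize (Sum.elim d c) := by
  obtain ⟨l, φ, e, hφ⟩ := exists_formula_fin (C := C) ψ
  obtain ⟨n, hn⟩ := hNIP.exists_noPatterns φ
  obtain ⟨a, haM, ha⟩ := h.exists_majority hn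
  refine ⟨(majority φ (2 * n)).relabel
    (Sum.map (fun p => (⟨a p.1 p.2, haM p.1 p.2⟩ : M)) e), fun c => ?_⟩
  simp only [hφ, ← ha, Formula.realize_relabel]
  refine iff_of_eq (congrArg _ ?_)
  funext p
  cases p <;> rfl

/-- Here the earlier members are found first, each inside `P`: definability of the average expresses
over `M` that `U`-most `d` complete them. The condition on the last member then has parameters in
`M`, so it holds `U'`-often and is compatible with `P`. -/
theorem IsStableAverage.exists_realize_mem (h : IsStableAverage L U M) (hNIP : HasNIP L C)
    {U' : Ultrafilter (Fin m → C)} (hU' : ∀ᶠ d : Fin m → C in U', ∀ j, d j ∈ M)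
    (hUU' : ∀ ψ : L.Formula (M ⊕ Fin m), (∀ᶠ d in U, ψ.Realize (Sum.elim Subtype.val d)) →
      ∀ᶠ d in U', ψ.Realize (Sum.elim Subtype.val d))
    {P : (Fin m → C) → Prop} (hP : ∀ᶠ d in U', P d) : ∀ {n : ℕ} {a : Fin n → Fin m → C},
      IsMorley L U M a → ∀ χ : L.Formula (M ⊕ (Fin n × Fin m)),
        χ.Realize (Sum.elim Subtype.val fun x => a x.1 x.2) →
          ∃ d : Fin n → Fin m → C, (∀ i j, d i j ∈ M) ∧ (∀ i, P (d i)) ∧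
            χ.Realize (Sum.elim Subtype.val fun x => d x.1 x.2)
  | 0, a, _, χ, hχ => ⟨a, fun i => i.elim0, fun i => i.elim0, hχ⟩
  | n + 1, a, ha, χ, hχ => by
    obtain ⟨δ, hδ⟩ := h.exists_definition hNIP ((χ.relabel splitLast).relabel Sum.swap)
    simp only [Formula.realize_relabel, elim_comp_swap] at hδ
    have hval : ∀ e : Fin n → Fin m → C,
        (δ.relabel (Sum.elim Sum.inl id)).Realize (Sum.elim Subtype.val fun x => e x.1 x.2) ↔
          ∀ᶠ d in U, χ.Realize (Sum.elim Subtype.val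
            fun x => (Fin.snoc e d : Fin (n + 1) → Fin m → C) x.1 x.2) := by
      intro e
      simp only [← elim_comp_splitLast, ← hδ, Formula.realize_relabel]
      refine iff_of_eq (congrArg _ ?_)
      funext p
      cases p <;> rfl
    obtain ⟨e, heM, heP, he⟩ := h.exists_realize_mem hNIP hU' hUU' hP ha.init
      (δ.relabel (Sum.elim Sum.inl id)) ((hval _).2 ((ha.realize_last χ _ fun i => i.2).1 hχ))
    let ξ : L.Formula (M ⊕ Fin m) := (χ.relabel splitLast).relabel
      (Sum.map (Sum.elim id fun x => (⟨e x.1 x.2, heM x.1 x.2⟩ : M)) id)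
    have hξ : ∀ d : Fin m → C, ξ.Realize (Sum.elim Subtype.val d) ↔ χ.Realize (Sum.elim Subtype.val
        fun x => (Fin.snoc e d : Fin (n + 1) → Fin m → C) x.1 x.2) := by
      intro d
      rw [← elim_comp_splitLast, Formula.realize_relabel, Formula.realize_relabel]
      refine iff_of_eq (congrArg (fun f => χ.Realize (f ∘ splitLast)) ?_)
      funext p
      rcases p with (p | p) | p <;> rfl
    obtain ⟨d, hdM, hdP, hd⟩ := (hU'.and (hP.and (hUU' ξ (((hval e).1 he).mono
      fun d => (hξ d).2)))).exists
    refine ⟨Fin.snoc e d, fun i j => ?_, fun i => ?_, (hξ d).1 hd⟩ <;>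
      induction i using Fin.lastCases with
      | last => simp [hdM, hdP]
      | cast i => simp [heM, heP]

/-- Any `n` members of a Morley sequence of `U` include one satisfying `φ(x̄, z̄)`, for every `z̄`
whose instance is in the average. This is a property over `M`; were `φ(x̄, c)` false `U'`-often, it
would be realized by tuples all failing `φ(x̄, c)`. -/
theorem IsStableAverage.eventually_of_agree (h : IsStableAverage L U M) (hNIP : HasNIP L C)
    {U' : Ultrafilter (Fin m → C)} (hU' : ∀ᶠ d : Fin m → C in U', ∀ j, d j ∈ M)
    (hUU' : ∀ ψ : L.Formula (M ⊕ Fin m), (∀ᶠ d in U, ψ.Realize (Sum.elim Subtype.val d)) →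
      ∀ᶠ d in U', ψ.Realize (Sum.elim Subtype.val d)) {l : ℕ} (φ : L.Formula (Fin m ⊕ Fin l))
    (c : Fin l → C) (hc : ∀ᶠ d in U, φ.Realize (Sum.elim d c)) :
    ∀ᶠ d in U', φ.Realize (Sum.elim d c) := by
  by_contra hc'
  rw [← Ultrafilter.eventually_not] at hc'
  obtain ⟨n, hn⟩ := hNIP.exists_noPatterns φ
  obtain ⟨δ, hδ⟩ := h.exists_definition hNIP φ
  obtain ⟨a, ha⟩ := h.exists_isMorley ∅ Set.finite_empty n
  rw [Set.union_empty] at ha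
  let χ : L.Formula (M ⊕ (Fin n × Fin m)) := Formula.iAlls (Fin l)
    ((δ.relabel (Sum.map Sum.inl id)).imp (Formula.iSup fun i : Fin n =>
      φ.relabel (Sum.map (fun j => Sum.inr (i, j)) id)))
  have hχ : ∀ a : Fin n → Fin m → C, χ.Realize (Sum.elim Subtype.val fun x => a x.1 x.2) ↔
      ∀ z : Fin l → C, δ.Realize (Sum.elim Subtype.val z) →
        ∃ i, φ.Realize (Sum.elim (a i) z) := by
    intro a
    simp only [χ, Formula.realize_iAlls, Formula.realize_imp, Formula.realize_iSup,
      Formula.realize_relabel]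
    refine forall_congr' fun z => imp_congr ?_ (exists_congr fun i => ?_) <;>
    · refine iff_of_eq (congrArg _ ?_)
      funext p
      cases p <;> rfl
  obtain ⟨d, -, hd, hdχ⟩ := h.exists_realize_mem hNIP hU' hUU' hc' ha χ ((hχ a).2 fun z hz => by
    have hlt := h.encard_not_lt hn ha z ((hδ z).1 hz)
    by_contra hall
    have huniv : {t | ¬ φ.Realize (Sum.elim (a t) z)} = Set.univ :=
      Set.eq_univ_of_forall fun i hi => hall ⟨i, hi⟩
    rw [huniv, Set.encard_univ, ENat.card_eq_coe_fintype_card, Fintype.card_fin] at hlt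
    exact lt_irrefl _ hlt)
  obtain ⟨i, hi⟩ := (hχ d).1 hdχ c ((hδ c).2 hc)
  exact hd i hi

theorem IsStableAverage.eventually_iff_of_agree (h : IsStableAverage L U M) (hNIP : HasNIP L C)
    {U' : Ultrafilter (Fin m → C)} (hU' : ∀ᶠ d : Fin m → C in U', ∀ j, d j ∈ M)
    (hUU' : ∀ ψ : L.Formula (M ⊕ Fin m), (∀ᶠ d in U, ψ.Realize (Sum.elim Subtype.val d)) →
      ∀ᶠ d in U', ψ.Realize (Sum.elim Subtype.val d)) {l : ℕ} (φ : L.Formula (Fin m ⊕ Fin l))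
    (c : Fin l → C) : (∀ᶠ d in U, φ.Realize (Sum.elim d c)) ↔
      ∀ᶠ d in U', φ.Realize (Sum.elim d c) := by
  refine ⟨h.eventually_of_agree hNIP hU' hUU' φ c, fun hc => ?_⟩
  by_contra hn
  rw [← Ultrafilter.eventually_not] at hn
  exact Ultrafilter.eventually_not.1 (h.eventually_of_agree hNIP hU' hUU' φ.not c hn) hc

theorem eventually_congr_of_agree {U U' : Ultrafilter (Fin m → C)}
    (hUU' : ∀ (l : ℕ) (φ : L.Formula (Fin m ⊕ Fin l)) (c : Fin l → C),
      (∀ᶠ d in U, φ.Realize (Sum.elim d c)) ↔ ∀ᶠ d in U', φ.Realize (Sum.elim d c))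
    {α : Type*} (ψ : L.Formula (α ⊕ Fin m)) (c : α → C) :
    (∀ᶠ d in U, ψ.Realize (Sum.elim c d)) ↔ ∀ᶠ d in U', ψ.Realize (Sum.elim c d) := by
  obtain ⟨l, φ, e, hφ⟩ := exists_formula_fin (C := C) (ψ.relabel Sum.swap)
  simp only [Formula.realize_relabel, elim_comp_swap] at hφ
  simp only [hφ]
  exact hUU' l φ _

end Stable

/-! ### Translation between ultrafilters on tuples of `M` and global averages. -/

section Translation

open FirstOrder.Language Filter

variable {L : FirstOrder.Language.{u, v}} {C : Type w} [L.Structure C] {m : ℕ} {M : Set C}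

/-- An ultrafilter on tuples from `M` as an ultrafilter on tuples from `C`. -/
def extend (D : Ultrafilter (Fin m → M)) : Ultrafilter (Fin m → C) :=
  D.map fun d i => (d i : C)

theorem eventually_extend {D : Ultrafilter (Fin m → M)} {P : (Fin m → C) → Prop} :
    (∀ᶠ d in extend D, P d) ↔ {d : Fin m → M | P fun i => (d i : C)} ∈ D :=
  Iff.rfl

theorem eventually_extend_mem (D : Ultrafilter (Fin m → M)) :
    ∀ᶠ d : Fin m → C in extend D, ∀ j, d j ∈ M :=
  eventually_extend.2 (Filter.mem_of_superset Filter.univ_mem fun d _ j => (d j).2)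

theorem avOver_extend_iff {D : Ultrafilter (Fin m → M)} {B : Set C} {x : Fin m → C} :
    AvOver L (extend D) B x ↔ {ψ : L[[B]].Formula (Fin m) | ψ.Realize x} = Av L B D := by
  have key : ∀ ψ : L[[B]].Formula (Fin m), ψ ∈ Av L B D ↔ ∀ᶠ d in extend D,
      Formula.Realize (L := L) (α := B ⊕ Fin m) (BoundedFormula.constantsVarsEquiv ψ)
        (Sum.elim Subtype.val d) := by
    intro ψ
    simp only [← realize_constantsVars]
    exact Iff.rfl
  rw [Set.ext_iff]
  simp only [key, Set.mem_ofPred_eq, realize_constantsVars]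
  exact ⟨fun h ψ => h _, fun h ψ => by
    obtain ⟨χ, rfl⟩ := BoundedFormula.constantsVarsEquiv.surjective ψ
    exact h χ⟩

theorem isMorley_extend_iff {D : Ultrafilter (Fin m → M)} {I : Type w} [LinearOrder I]
    {b : I → Fin m → C} : IsMorley L (extend D) M b ↔ IsDIndiscernible L D b :=
  forall_congr' fun _ => avOver_extend_iff

/-- Total indiscernibility passes from the given infinite sequence to all finite Morley sequences
over `M`, since they have the type of its increasing subsequences. -/
theorem IsSaturated.isStableAverage {κ : Cardinal.{w}} (hC : IsSaturated L C κ) (hκ : ℵ₀ ≤ κ)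
    (hM : #M < κ) {D : Ultrafilter (Fin m → M)} {I : Type w} [LinearOrder I] [Infinite I]
    {b : I → Fin m → C} (hb : IsDIndiscernible L D b) (hset : IsIndiscernibleSet L b) :
    IsStableAverage L (extend D) M where
  mem := eventually_extend_mem D
  exists_isMorley F hF n := by
    have := hF.to_subtype
    refine hC.exists_isMorley hκ _ _ ?_ n
    simpa using mk_union_range_lt hκ hM (Subtype.val : F → C)
  perm n a ha σ ψ := by
    obtain ⟨f, hf, -⟩ := exists_strictMono_of_le_encard (n := n) (S := (Set.univ : Set I))
      (by rw [Set.infinite_univ.encard_eq]; exact le_top)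
    have hfb := (isMorley_extend_iff.2 hb).comp hf
    have h1 := hset n (σ.toEmbedding.trans ⟨f, hf.injective⟩) ⟨f, hf.injective⟩ ψ
    have h2 := ha.realize_congr' (eventually_extend_mem D) hfb ψ
    have h3 := ha.realize_congr' (eventually_extend_mem D) hfb (ψ.relabel fun x => (σ x.1, x.2))
    simp only [Formula.realize_relabel] at h3
    exact h3.trans (h1.trans h2.symm)

theorem IsAverageSeq.inType_iff {p : TypesOver L M m} {D : Ultrafilter (Fin m → M)} {I : Type w}
    [LinearOrder I] {b : I → Fin m → C} (h : IsAverageSeq p D b) (ψ : L[[M]].Formula (Fin m)) :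
    InType p ψ ↔ ∀ᶠ d : Fin m → C in extend D, ψ.Realize d :=
  (Set.ext_iff.1 h.av_eq ψ).symm

theorem IsAverageSeq.mem_restrictSet_iff {p : TypesOver L M m} {D : Ultrafilter (Fin m → M)}
    {I : Type w} [LinearOrder I] {b : I → Fin m → C} (h : IsAverageSeq p D b) {l : ℕ}
    (φ : L.Formula (Fin m ⊕ Fin l)) (c : Fin l → M) :
    c ∈ restrictSet p φ ↔ ∀ᶠ d in extend D, φ.Realize (Sum.elim d fun j => (c j : C)) := by
  refine (h.inType_iff _).trans (eventually_congr (Eventually.of_forall fun d => ?_))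
  unfold instParam
  refine BoundedFormula.realize_subst.trans (((L.lhomWithConstants M).realize_onFormula φ).trans ?_)
  refine iff_of_eq (congrArg _ ?_)
  funext y
  cases y
  · rfl
  · exact Term.realize_constants

theorem IsAverageSeq.eventually_iff {p : TypesOver L M m} {D D' : Ultrafilter (Fin m → M)}
    {I I' : Type w} [LinearOrder I] [LinearOrder I'] {b : I → Fin m → C} {b' : I' → Fin m → C}
    (h : IsAverageSeq p D b) (h' : IsAverageSeq p D' b') (ψ : L.Formula (M ⊕ Fin m)) :
    (∀ᶠ d in extend D, ψ.Realize (Sum.elim Subtype.val d)) ↔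
      ∀ᶠ d in extend D', ψ.Realize (Sum.elim Subtype.val d) := by
  obtain ⟨χ, rfl⟩ := BoundedFormula.constantsVarsEquiv.surjective ψ
  have h1 := (h.inType_iff χ).symm.trans (h'.inType_iff χ)
  simpa only [realize_constantsVars] using h1

end Translation

/-! ### Independence of the canonical base from the Morley sequence. -/

section CanonicalBase

open FirstOrder.Language Filter

variable {L : FirstOrder.Language.{u, v}} {C : Type w} [L.Structure C] {m : ℕ}
  {U : Ultrafilter (Fin m → C)} {M : Set C}

theorem IsStableAverage.isAveraging (h : IsStableAverage L U M) (hNIP : HasNIP L C) {I : Type w}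
    [LinearOrder I] {b : I → Fin m → C} (hb : IsMorley L U M b) {l : ℕ}
    (φ : L.Formula (Fin m ⊕ Fin l)) : IsAveraging φ b := by
  intro c
  obtain ⟨n, hn⟩ := hNIP.exists_noPatterns φ
  by_cases hc : ∀ᶠ d in U, φ.Realize (Sum.elim d c)
  · exact Or.inr (Set.encard_lt_top_iff.1 ((h.encard_not_lt hn hb c hc).trans_le le_top))
  · exact Or.inl (Set.encard_lt_top_iff.1 ((h.encard_lt hn hb c hc).trans_le le_top))

theorem IsStableAverage.exists_isAvNumber (h : IsStableAverage L U M) (hNIP : HasNIP L C)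
    {I : Type w} [LinearOrder I] {b : I → Fin m → C} (hb : IsMorley L U M b) {l : ℕ}
    (φ : L.Formula (Fin m ⊕ Fin l)) : ∃ k, IsAvNumber φ b k := by
  obtain ⟨n, hn⟩ := hNIP.exists_noPatterns φ
  have hne : {k : ℕ | ∀ c : Fin l → C, 2 * {t | φ.Realize (Sum.elim (b t) c)}.encard < k ∨
      2 * {t | ¬ φ.Realize (Sum.elim (b t) c)}.encard < k}.Nonempty := by
    refine ⟨2 * n, fun c => ?_⟩
    by_cases hc : ∀ᶠ d in U, φ.Realize (Sum.elim d c)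
    · exact Or.inr (two_mul_encard_lt (h.encard_not_lt hn hb c hc))
    · exact Or.inl (two_mul_encard_lt (h.encard_lt hn hb c hc))
  exact ⟨_, Nat.sInf_mem hne, fun k hk => Nat.sInf_le hk⟩

/-- The number `k` need not be `2n`. But the side with fewer than `k/2` members is finite, as is the
side rejected by the average; the sequence being infinite, these are the same side. -/
theorem IsStableAverage.majority_iff_of_isAvNumber (h : IsStableAverage L U M) (hNIP : HasNIP L C)
    {I : Type w} [LinearOrder I] [Infinite I] {b : I → Fin m → C} (hb : IsMorley L U M b) {l : ℕ}
    {φ : L.Formula (Fin m ⊕ Fin l)} {k : ℕ} (hk : IsAvNumber φ b k) (t : Fin k ↪ I)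
    (c : Fin l → C) : (majority φ k).Realize (Sum.elim (fun y => b (t y.1) y.2) c) ↔
      ∀ᶠ d in U, φ.Realize (Sum.elim d c) := by
  obtain ⟨n, hn⟩ := hNIP.exists_noPatterns φ
  have hle : ∀ P : I → Prop, 2 * {x | P x}.encard < k → 2 * {i : Fin k | P (t i)}.encard < k := by
    intro P hP
    refine (mul_le_mul_right ?_ 2).trans_lt hP
    rw [← t.injective.encard_image]
    exact Set.encard_le_encard (by rintro _ ⟨i, hi, rfl⟩; exact hi)
  have hfin : ∀ P : I → Prop, 2 * {x | P x}.encard < k → {x | P x}.Finite := by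
    intro P hP
    rw [← Set.encard_lt_top_iff]
    refine lt_of_le_of_lt ?_ (hP.trans_le le_top)
    rw [two_mul]
    exact le_self_add
  have hinf : ∀ P : I → Prop, {x | P x}.Finite → {x | ¬ P x}.Finite → False := by
    intro P h1 h2
    refine Set.infinite_univ (α := I) ((h1.union h2).subset fun x _ => ?_)
    exact em (P x)
  rw [realize_majority φ k fun i => b (t i)]
  rcases hk.1 c with h1 | h1
  · refine iff_of_false (not_majority_of_encard_lt
      (hle (fun x => φ.Realize (Sum.elim (b x) c)) h1)) fun hc => ?_
    exact hinf _ (hfin _ h1)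
      (Set.encard_lt_top_iff.1 ((h.encard_not_lt hn hb c hc).trans_le le_top))
  · refine iff_of_true (majority_of_encard_not_lt
      (hle (fun x => ¬ φ.Realize (Sum.elim (b x) c)) h1)) ?_
    by_contra hc
    exact hinf _ (Set.encard_lt_top_iff.1 ((h.encard_lt hn hb c hc).trans_le le_top)) (hfin _ h1)

theorem IsStableAverage.avNumber_transfer (h : IsStableAverage L U M) {I I' : Type w}
    [LinearOrder I] [LinearOrder I'] [Infinite I] {b : I → Fin m → C}
    {b' : I' → Fin m → C} (hb : IsMorley L U M b) (hb' : IsMorley L U M b') {l : ℕ}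
    (φ : L.Formula (Fin m ⊕ Fin l)) {k : ℕ}
    (hk : ∀ c : Fin l → C, 2 * {t | φ.Realize (Sum.elim (b t) c)}.encard < k ∨
      2 * {t | ¬ φ.Realize (Sum.elim (b t) c)}.encard < k) (c : Fin l → C) :
    2 * {t | φ.Realize (Sum.elim (b' t) c)}.encard < k ∨
      2 * {t | ¬ φ.Realize (Sum.elim (b' t) c)}.encard < k := by
  by_contra hcon
  obtain ⟨h1, h2⟩ := not_or.1 hcon
  -- `j` is `k/2` rounded up: a set fails to have fewer than `k/2` members exactly when it has at
  -- least `j`. A failure at `c` is thus a pattern of `j` true and `j` false instances, which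
  -- transfers to `b` with a new parameter.
  let j := (k + 1) / 2
  have hj : ∀ S : Set I', ¬ 2 * S.encard < k → (j : ℕ∞) ≤ S.encard := by
    intro S hS
    by_contra hlt
    rw [not_le] at hlt
    lift S.encard to ℕ using (hlt.trans_le le_top).ne with e
    have h1 : e < (k + 1) / 2 := by exact_mod_cast hlt
    have h2 : ¬ 2 * e < k := by exact_mod_cast hS
    omega
  obtain ⟨f, hf, hfS⟩ := exists_strictMono_of_le_encard (hj _ h1)
  obtain ⟨g, hg, hgS⟩ := exists_strictMono_of_le_encard (hj _ h2)
  let s : Fin (j + j) ↪ I' := ⟨Fin.append f g, Fin.append_injective_iff.2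
    ⟨hf.injective, hg.injective, fun i i' hii => hgS i' (hii ▸ hfS i)⟩⟩
  have hs : ∀ i, φ.Realize (Sum.elim (b' (s i)) c) ↔ (i : ℕ) < j := by
    intro i
    induction i using Fin.addCases with
    | left i =>
      have hi := hfS i
      rw [← Fin.append_left f g i] at hi
      exact iff_of_true hi i.2
    | right i =>
      have hi := hgS i
      rw [← Fin.append_right f g i] at hi
      exact iff_of_false hi (by simp)
  obtain ⟨a, ha⟩ := h.exists_isMorley ∅ Set.finite_empty (j + j)
  rw [Set.union_empty] at ha
  let t : Fin (j + j) ↪ I := Fin.valEmbedding.trans (Infinite.natEmbedding I)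
  obtain ⟨c', hc'⟩ := (h.exists_pattern φ hb t ha (fun i => (i : ℕ) < j)).2
    ((h.exists_pattern φ hb' s ha (fun i => (i : ℕ) < j)).1 ⟨c, hs⟩)
  have hcount : ∀ (P : I → Prop) (r : Fin j ↪ Fin (j + j)), (∀ i, P (t (r i))) →
      ¬ 2 * {x | P x}.encard < k := by
    intro P r hP hlt
    have hle : (j : ℕ∞) ≤ {x | P x}.encard := by
      have : (Set.range (r.trans t)).encard = j := by
        rw [← Set.image_univ, (r.trans t).injective.encard_image, Set.encard_univ,
          ENat.card_eq_coe_fintype_card, Fintype.card_fin]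
      rw [← this]
      exact Set.encard_le_encard (by rintro _ ⟨i, rfl⟩; exact hP i)
    have h3 : (2 : ℕ∞) * j < k := (mul_le_mul_right hle 2).trans_lt hlt
    have h4 : 2 * j < k := by exact_mod_cast h3
    omega
  rcases hk c' with h3 | h3
  · exact hcount _ (Fin.castAddEmb j) (fun i => (hc' _).2 (by simp)) h3
  · exact hcount _ (Fin.natAddEmb j) (fun i hi => by simpa using (hc' _).1 hi) h3

theorem IsStableAverage.isAvNumber_transfer (h : IsStableAverage L U M) {I I' : Type w}
    [LinearOrder I] [LinearOrder I'] [Infinite I] [Infinite I'] {b : I → Fin m → C}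
    {b' : I' → Fin m → C} (hb : IsMorley L U M b) (hb' : IsMorley L U M b') {l : ℕ}
    (φ : L.Formula (Fin m ⊕ Fin l)) {k : ℕ} (hk : IsAvNumber φ b k) : IsAvNumber φ b' k :=
  ⟨h.avNumber_transfer hb hb' φ hk.1, fun _ hk' => hk.2 (h.avNumber_transfer hb' hb φ hk')⟩

theorem IsStableAverage.Cb_eq (h : IsStableAverage L U M) (hNIP : HasNIP L C) {I I' : Type w}
    [LinearOrder I] [LinearOrder I'] [Infinite I] [Infinite I'] {b : I → Fin m → C}
    {b' : I' → Fin m → C} (hb : IsMorley L U M b) (hb' : IsMorley L U M b') :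
    Cb L b = Cb L b' := by
  have aux : ∀ {I I' : Type w} [LinearOrder I] [LinearOrder I'] [Infinite I] [Infinite I']
      {b : I → Fin m → C} {b' : I' → Fin m → C}, IsMorley L U M b → IsMorley L U M b' →
      ∀ e : Ceq L C, (∃ (l : ℕ) (φ : L.Formula (Fin m ⊕ Fin l)) (k : ℕ) (t : Fin k ↪ I),
        IsAveraging φ b ∧ IsAvNumber φ b k ∧
          e = Ceq.cls (majEq C φ k) (Quotient.mk (majEq C φ k).setoid
            (fun x => b (t (finProdFinEquiv.symm x).1) (finProdFinEquiv.symm x).2))) →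
      ∃ (l : ℕ) (φ : L.Formula (Fin m ⊕ Fin l)) (k : ℕ) (t : Fin k ↪ I'),
        IsAveraging φ b' ∧ IsAvNumber φ b' k ∧
          e = Ceq.cls (majEq C φ k) (Quotient.mk (majEq C φ k).setoid
            (fun x => b' (t (finProdFinEquiv.symm x).1) (finProdFinEquiv.symm x).2)) := by
    rintro I I' _ _ _ _ b b' hb hb' e ⟨l, φ, k, t, -, hk, rfl⟩
    have hk' := h.isAvNumber_transfer hb hb' φ hk
    let t' : Fin k ↪ I' := Fin.valEmbedding.trans (Infinite.natEmbedding I')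
    refine ⟨l, φ, k, t', h.isAveraging hNIP hb' φ, hk', congrArg _ (Quotient.sound ?_)⟩
    refine (realize_majEqFormula φ k _ _).2 fun z => ?_
    simp only [Equiv.symm_apply_apply]
    rw [h.majority_iff_of_isAvNumber hNIP hb hk, h.majority_iff_of_isAvNumber hNIP hb' hk']
  exact congrArg (dcl (Leq L C)) (Set.ext fun e => ⟨aux hb hb' e, aux hb' hb e⟩)

end CanonicalBase

/-! ### Definability in `C^eq`. -/

section Imaginaries

open FirstOrder.Language

variable {L : FirstOrder.Language.{u, v}} {C : Type w} [L.Structure C]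

theorem definable_proj (E : EqFormula L C) : (∅ : Set (Ceq L C)).Definable (Leq L C)
    {x : Fin (E.arity + 1) → Ceq L C | ∃ a : Fin E.arity → C,
      x = Fin.snoc (α := fun _ => Ceq L C) (fun i => Ceq.real (a i))
        (Ceq.cls E (Quotient.mk E.setoid a))} := by
  refine Set.empty_definable_iff.2 ⟨Relations.formula (L := Leq L C) (n := E.arity + 1)
    (EqRel.proj E) fun i => Term.var i, ?_⟩
  ext x
  exact (Formula.realize_rel (L := Leq L C) (M := Ceq L C) (k := E.arity + 1)
    (R := EqRel.proj E) (ts := fun i => Term.var i) (v := x)).symm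

/-- The formula `x̄ = ȳ ∧ (θ(x̄) ∨ s = t)` in `x̄s` and `ȳt`. It identifies distinct tuples `x̄s` and
`x̄t` if and only if `θ(x̄)`. -/
noncomputable def guardEqFormula {N : ℕ} (θ : L.Formula (Fin N)) :
    L.Formula (Fin (N + 1) ⊕ Fin (N + 1)) :=
  (Formula.iInf fun i : Fin N =>
      (Term.var (Sum.inl i.castSucc)).equal (Term.var (Sum.inr i.castSucc))) ⊓
    (θ.relabel (fun i => Sum.inl i.castSucc) ⊔
      (Term.var (Sum.inl (Fin.last N))).equal (Term.var (Sum.inr (Fin.last N))))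

theorem realize_guardEqFormula {N : ℕ} (θ : L.Formula (Fin N)) (a b : Fin (N + 1) → C) :
    (guardEqFormula θ).Realize (Sum.elim a b) ↔ (∀ i : Fin N, a i.castSucc = b i.castSucc) ∧
      (θ.Realize (fun i => a i.castSucc) ∨ a (Fin.last N) = b (Fin.last N)) := by
  simp only [guardEqFormula, Formula.realize_inf, Formula.realize_sup, Formula.realize_iInf,
    Formula.realize_equal, Term.realize_var, Formula.realize_relabel, Sum.elim_inl, Sum.elim_inr,
    Function.comp_def]

variable (C) in
/-- `guardEqFormula θ` as an index of a sort of `C^eq`. -/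
noncomputable def guardEq {N : ℕ} (θ : L.Formula (Fin N)) : EqFormula L C where
  arity := N + 1
  formula := guardEqFormula θ
  equiv := by
    simp only [realize_guardEqFormula]
    refine ⟨fun a => ⟨fun _ => rfl, Or.inr rfl⟩, fun {a b} h => ⟨fun i => (h.1 i).symm, ?_⟩,
      fun {a b c} h h' => ⟨fun i => (h.1 i).trans (h'.1 i), ?_⟩⟩
    · refine h.2.imp (fun hθ => ?_) Eq.symm
      rwa [← funext h.1]
    · rcases h.2 with hθ | hab
      · exact Or.inl hθ
      · refine h'.2.imp (fun hθ => ?_) hab.trans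
        rwa [funext h.1]

theorem guardEq_mk_eq_iff {N : ℕ} (θ : L.Formula (Fin N)) (a b : Fin (N + 1) → C) :
    (Quotient.mk (guardEq C θ).setoid a = Quotient.mk (guardEq C θ).setoid b) ↔
      (∀ i : Fin N, a i.castSucc = b i.castSucc) ∧
        (θ.Realize (fun i => a i.castSucc) ∨ a (Fin.last N) = b (Fin.last N)) :=
  (Quotient.eq (r := (guardEq C θ).setoid)).trans (realize_guardEqFormula θ a b)

theorem cls_injective (E : EqFormula L C) : Function.Injective (Ceq.cls E) := by
  intro q q' h
  cases h
  rfl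

theorem real_injective : Function.Injective (Ceq.real : C → Ceq L C) := by
  intro a a' h
  cases h
  rfl

/-- No induction on `θ` is needed: `θ(x̄)` holds iff there are distinct real `s`, `t` for which
`x̄s` and `x̄t` have the same class in the sort of `guardEq`. Two distinct elements must exist. -/
theorem definable_real_fin [Nontrivial C] {N : ℕ} (θ : L.Formula (Fin N)) :
    (∅ : Set (Ceq L C)).Definable (Leq L C)
      {x : Fin N → Ceq L C | ∃ a : Fin N → C, x = (fun i => Ceq.real (a i)) ∧ θ.Realize a} := by
  -- The extra variables `0` and `1` are the last coordinates `s` and `t`, and `2` is the common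
  -- class; only `f 0` and `f 1` are used.
  let f : Fin 3 → Fin (N + 1 + 1) → Fin N ⊕ Fin 3 := fun r =>
    Fin.snoc (α := fun _ => Fin N ⊕ Fin 3) (Fin.snoc (α := fun _ => Fin N ⊕ Fin 3)
      Sum.inl (Sum.inr r)) (Sum.inr 2)
  have hne : (∅ : Set (Ceq L C)).Definable (Leq L C)
      {x : Fin N ⊕ Fin 3 → Ceq L C | x (Sum.inr 0) = x (Sum.inr 1)} :=
    (Set.Definable.diagonal (Leq L C) ∅).preimage_comp
      (![Sum.inr 0, Sum.inr 1] : Fin 2 → Fin N ⊕ Fin 3)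
  have hS := (((definable_proj (guardEq C θ)).preimage_comp (f 0)).inter
    ((definable_proj (guardEq C θ)).preimage_comp (f 1))).inter hne.compl
  convert! hS.exists_of_finite using 1
  have hf : ∀ (r : Fin 3) (x : Fin N → Ceq L C) (y : Fin 3 → Ceq L C), Sum.elim x y ∘ f r =
      Fin.snoc (α := fun _ => Ceq L C) (Fin.snoc (α := fun _ => Ceq L C) x (y r)) (y 2) := by
    intro r x y
    funext i
    induction i using Fin.lastCases with
    | last => simp [f]
    | cast i =>
      induction i using Fin.lastCases with
      | last => simp [f]
      | cast i => simp [f]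
  ext x
  constructor
  · rintro ⟨a, rfl, ha⟩
    obtain ⟨c, c', hcc⟩ := exists_pair_ne C
    let A : C → Fin (N + 1) → C := fun y => Fin.snoc (α := fun _ => C) a y
    have hA : Quotient.mk (guardEq C θ).setoid (A c) = Quotient.mk (guardEq C θ).setoid (A c') :=
      (guardEq_mk_eq_iff θ _ _).2 ⟨fun i => by simp [A], Or.inl (by simpa [A] using ha)⟩
    have hsnoc : ∀ y : C, (Fin.snoc (α := fun _ => Ceq L C) (fun i => Ceq.real (a i))
        (Ceq.real y) : Fin (N + 1) → Ceq L C) = fun i => Ceq.real (A y i) := by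
      intro y
      funext i
      induction i using Fin.lastCases with
      | last => simp [A]
      | cast i => simp [A]
    refine ⟨![Ceq.real c, Ceq.real c', Ceq.cls _ (Quotient.mk (guardEq C θ).setoid (A c))],
      ⟨⟨A c, ?_⟩, ⟨A c', ?_⟩⟩, fun h => hcc (real_injective h)⟩
    · exact (hf _ _ _).trans (congrArg (fun g => Fin.snoc (α := fun _ => Ceq L C) g _) (hsnoc c))
    · rw [← hA]
      exact (hf _ _ _).trans (congrArg (fun g => Fin.snoc (α := fun _ => Ceq L C) g _) (hsnoc c'))
  · rintro ⟨y, ⟨⟨a, ha⟩, ⟨a', ha'⟩⟩, hy⟩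
    replace ha := (hf _ _ _).symm.trans ha
    replace ha' := (hf _ _ _).symm.trans ha'
    obtain ⟨h1, h2⟩ := Fin.snoc_injective2 ha
    obtain ⟨h1', h2'⟩ := Fin.snoc_injective2 ha'
    have h3 := (guardEq_mk_eq_iff θ a a').1 (cls_injective _ (h2.symm.trans h2'))
    have hx : ∀ i : Fin N, x i = Ceq.real (a i.castSucc) := by
      intro i
      simpa using congrFun h1 i.castSucc
    refine ⟨fun i => a i.castSucc, funext hx, h3.2.resolve_right fun hl => hy ?_⟩
    have h4 := congrFun h1 (Fin.last N)
    have h4' := congrFun h1' (Fin.last N)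
    simp only [Fin.snoc_last] at h4 h4'
    change y 0 = y 1
    rw [h4, h4', hl]

theorem definable_real [Nontrivial C] {β : Type*} [Finite β] (θ : L.Formula β) :
    (∅ : Set (Ceq L C)).Definable (Leq L C)
      {x : β → Ceq L C | ∃ a : β → C, x = (fun i => Ceq.real (a i)) ∧ θ.Realize a} := by
  obtain ⟨N, ⟨e⟩⟩ := Finite.exists_equiv_fin β
  convert! (definable_real_fin (C := C) (θ.relabel e)).preimage_comp e.symm using 1
  ext x
  constructor
  · rintro ⟨a, rfl, ha⟩
    refine ⟨a ∘ e.symm, rfl, ?_⟩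
    rw [Formula.realize_relabel]
    simpa [Function.comp_assoc] using ha
  · rintro ⟨a, hx, ha⟩
    rw [Formula.realize_relabel] at ha
    refine ⟨a ∘ e, ?_, ha⟩
    funext i
    simpa using congrFun hx (e i)

/-- `Y` says that some representative of the class has majority true at `z̄`. All representatives
agree on this, by the choice of `majEq`. -/
theorem exists_definable_majority {m l : ℕ} (φ : L.Formula (Fin m ⊕ Fin l)) (k : ℕ)
    (b : Fin k → Fin m → C) {X : Set (Ceq L C)}
    (hX : Ceq.cls (majEq C φ k) (Quotient.mk (majEq C φ k).setoid
      (fun x => b (finProdFinEquiv.symm x).1 (finProdFinEquiv.symm x).2)) ∈ X) :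
    ∃ Y : Set (Fin l → Ceq L C), X.Definable (Leq L C) Y ∧ ∀ c : Fin l → C,
      (majority φ k).Realize (Sum.elim (fun y => b y.1 y.2) c) ↔
        (fun j => Ceq.real (c j)) ∈ Y := by
  -- With at most one element in `C` the guard sorts are useless, but there is at most one real
  -- tuple, so `Y` can be everything or empty.
  rcases subsingleton_or_nontrivial C with hC | hC
  · by_cases h : ∃ c : Fin l → C, (majority φ k).Realize (Sum.elim (fun y => b y.1 y.2) c)
    · obtain ⟨c, hc⟩ := h
      refine ⟨Set.univ, Set.definable_univ, fun c' => ?_⟩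
      rw [Subsingleton.elim c' c]
      exact iff_of_true hc trivial
    · exact ⟨∅, Set.definable_empty, fun c' => iff_of_false (fun hc => h ⟨c', hc⟩) id⟩
  set e := Ceq.cls (majEq C φ k) (Quotient.mk (majEq C φ k).setoid
    (fun x => b (finProdFinEquiv.symm x).1 (finProdFinEquiv.symm x).2)) with he
  let V := Fin l ⊕ ((Fin k × Fin m) ⊕ Fin 1)
  let f : Fin (k * m + 1) → V := Fin.snoc (α := fun _ => V)
    (fun i => Sum.inr (Sum.inl (finProdFinEquiv.symm i))) (Sum.inr (Sum.inr 0))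
  let g : (Fin k × Fin m) ⊕ Fin l → V := Sum.elim (fun y => Sum.inr (Sum.inl y)) Sum.inl
  have hf : ∀ (x : Fin l → Ceq L C) (y : (Fin k × Fin m) ⊕ Fin 1 → Ceq L C), Sum.elim x y ∘ f =
      Fin.snoc (α := fun _ => Ceq L C) (fun i => y (Sum.inl (finProdFinEquiv.symm i)))
        (y (Sum.inr 0)) := by
    intro x y
    funext i
    induction i using Fin.lastCases with
    | last => simp [f]
    | cast i => simp [f]
  have h1 := ((definable_real (C := C) (majority φ k)).preimage_comp g).mono (Set.empty_subset X)
  have h2 := ((definable_proj (majEq C φ k)).preimage_comp f).mono (Set.empty_subset X)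
  have h3 : X.Definable (Leq L C) {x : V → Ceq L C | x (Sum.inr (Sum.inr 0)) = e} :=
    (Set.Definable.singleton_of_mem (Leq L C) hX).preimage_comp
      (fun _ : Fin 1 => (Sum.inr (Sum.inr 0) : V))
  refine ⟨_, ((h1.inter h2).inter h3).exists_of_finite, fun c => ⟨fun hc => ?_, ?_⟩⟩
  · refine ⟨Sum.elim (fun y => Ceq.real (b y.1 y.2)) fun _ => e,
      ⟨⟨Sum.elim (fun y => b y.1 y.2) c, ?_, hc⟩,
        ⟨fun x => b (finProdFinEquiv.symm x).1 (finProdFinEquiv.symm x).2, hf _ _⟩⟩, rfl⟩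
    funext y
    cases y <;> rfl
  · rintro ⟨y, ⟨⟨a, ha, haφ⟩, ⟨a', ha'⟩⟩, hy⟩
    change y (Sum.inr 0) = e at hy
    replace ha' := (hf _ _).symm.trans ha'
    obtain ⟨h4, h5⟩ := Fin.snoc_injective2 ha'
    have h6 : ∀ z : Fin l → C, (majority φ k).Realize (Sum.elim (fun x => a' (finProdFinEquiv x)) z) ↔
        (majority φ k).Realize (Sum.elim (fun x => b x.1 x.2) z) := by
      have := Quotient.exact (s := (majEq C φ k).setoid)
        (cls_injective _ (h5.symm.trans (hy.trans he)))
      have := (realize_majEqFormula φ k _ _).1 this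
      simpa only [Equiv.symm_apply_apply] using this
    rw [← h6]
    convert! haφ using 1
    funext x
    rcases x with x | x
    · refine real_injective (L := L) ?_
      have h7 := congrFun ha (Sum.inl x)
      have h8 := congrFun h4 (finProdFinEquiv x)
      simp only [Equiv.symm_apply_apply] at h8
      exact h8.symm.trans h7
    · exact real_injective (L := L) (congrFun ha (Sum.inr x))

end Imaginaries

/-! ### Assembling the two statements. -/

section Main

open FirstOrder.Language Filter

variable {L : FirstOrder.Language.{u, v}}

theorem mk_formula_le (α : Type) [Finite α] : #(L.Formula α) ≤ cardT L := by
  have hinj : Function.Injective fun φ : L.Formula α => (⟨0, φ⟩ : Σ n, L.BoundedFormula α n) :=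
    sigma_mk_injective (β := fun n => L.BoundedFormula α n)
  refine (mk_le_of_injective hinj).trans (BoundedFormula.card_le.trans ?_)
  refine max_le (le_max_left _ _) (add_le_of_le (le_max_left _ _) ?_ ?_)
  · exact (lift_le_aleph0.2 (lt_aleph0_of_finite α).le).trans (le_max_left _ _)
  · simp [cardT]

variable (L) in
theorem mk_sigma_formula_le (m : ℕ) : #(Σ l : ℕ, L.Formula (Fin m ⊕ Fin l)) ≤ cardT L := by
  rw [mk_sigma]
  refine (sum_le_sum _ (fun _ => cardT L) fun l => mk_formula_le _).trans ?_
  rw [sum_const]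
  have h : ℵ₀ * cardT L ≤ cardT L := mul_le_of_le (le_max_left _ _) (le_max_left _ _) le_rfl
  simpa using h

variable {C : Type w} [L.Structure C] {m : ℕ}

theorem TypesOver.ext {A : Set C} {p q : TypesOver L A m} (h : ∀ ψ, InType p ψ ↔ InType q ψ) :
    p = q := by
  refine SetLike.ext fun σ => ?_
  simpa [InType] using h (Formula.equivSentence.symm σ)

theorem definable_univ_of_formula (M : L.ElementarySubstructure C) {β : Type*}
    (δ : L.Formula ((M : Set C) ⊕ β)) {S : Set (β → M)}
    (hS : ∀ c : β → M, c ∈ S ↔ δ.Realize (Sum.elim Subtype.val fun i => (c i : C))) :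
    (Set.univ : Set M).Definable L S := by
  refine Set.definable_iff_exists_formula_sum.2
    ⟨δ.relabel (Sum.map (fun x => ⟨x, trivial⟩) id), Set.ext fun c => (hS c).trans ?_⟩
  rw [Set.mem_ofPred_eq, ← M.subtype.map_formula, Formula.realize_relabel]
  refine iff_of_eq (congrArg _ ?_)
  funext y
  cases y <;> rfl

theorem nonempty_of_elementarySubstructure [Nonempty C] (M : L.ElementarySubstructure C) :
    Nonempty M := by
  have h : C ⊨ Sentence.cardGe L 1 := by
    rw [Sentence.realize_cardGe]
    simpa using Cardinal.one_le_iff_ne_zero.2 (mk_ne_zero C)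
  rw [← M.realize_sentence, Sentence.realize_cardGe] at h
  rw [← mk_ne_zero_iff, ← Cardinal.one_le_iff_ne_zero]
  simpa using h

theorem IsAverageSeq.isCbOfType {M : Set C} (hNIP : HasNIP L C) {p : TypesOver L M m}
    {D : Ultrafilter (Fin m → M)} {I : Type w} [LinearOrder I] {b : I → Fin m → C}
    (hb : IsAverageSeq p D b) (h : IsStableAverage L (extend D) M) : IsCbOfType p (Cb L b) := by
  refine ⟨⟨D, I, _, b, hb⟩, fun D' I' _ b' hb' => ?_⟩
  have := hb.infinite
  have := hb'.infinite
  have hagree : ∀ (l : ℕ) (φ : L.Formula (Fin m ⊕ Fin l)) (c : Fin l → C),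
      (∀ᶠ d in extend D, φ.Realize (Sum.elim d c)) ↔ ∀ᶠ d in extend D', φ.Realize (Sum.elim d c) :=
    fun l φ c => h.eventually_iff_of_agree hNIP (eventually_extend_mem D')
      (fun ψ => (hb.eventually_iff hb' ψ).1) φ c
  -- Agreement over all of `C`, not only over `M`, is needed here: the types involved also have
  -- earlier members of `b'` as parameters.
  have hM' : IsMorley L (extend D) M b' := fun t ψ =>
    ((isMorley_extend_iff.2 hb'.indisc) t ψ).trans (eventually_congr_of_agree hagree ψ _).symm
  exact h.Cb_eq hNIP hM' (isMorley_extend_iff.2 hb.indisc)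

theorem IsSaturated.exists_isStableAverage {κ : Cardinal.{w}} (hC : IsSaturated L C κ)
    (hκ : ℵ₀ ≤ κ) {M : Set C} (hM : #M < κ) {p : TypesOver L M m} (hp : IsStableType p) :
    ∃ (D : Ultrafilter (Fin m → M)) (I : Type w) (_ : LinearOrder I) (b : I → Fin m → C),
      IsAverageSeq p D b ∧ IsStableAverage L (extend D) M := by
  obtain ⟨D, I, _, b, hb, hset⟩ := hp
  have := hb.infinite
  exact ⟨D, I, _, b, hb, hC.isStableAverage hκ hM hb.indisc hset⟩

/-- A stable type is recovered from the tuples of `M` whose majorities define it. The lengths `2n`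
depend only on the formulas, so these tuples form one function into `M` from an index set of size at
most `|T|`. -/
theorem mk_stableTypes_le [Nonempty C] {κ : Cardinal.{w}} (hC : IsSaturated L C κ) (hκ : ℵ₀ ≤ κ)
    (hNIP : HasNIP L C) (M : L.ElementarySubstructure C) (hM : #M < κ) :
    #{p : TypesOver L (M : Set C) m // IsStableType p} ≤
      Cardinal.lift.{max u v} #M ^ Cardinal.lift.{w} (cardT L) := by
  choose D I hI b hb hD using fun p : {p : TypesOver L (M : Set C) m // IsStableType p} =>
    hC.exists_isStableAverage hκ (M := (M : Set C)) hM p.2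
  choose n hn using fun x : Σ l : ℕ, L.Formula (Fin m ⊕ Fin l) => hNIP.exists_noPatterns x.2
  choose a haM ha using fun (p : {p : TypesOver L (M : Set C) m // IsStableType p})
    (x : Σ l : ℕ, L.Formula (Fin m ⊕ Fin l)) => (hD p).exists_majority (hn x)
  let ι := Σ x : (Σ l : ℕ, L.Formula (Fin m ⊕ Fin l)), Fin (2 * n x) × Fin m
  let F : {p : TypesOver L (M : Set C) m // IsStableType p} → ι → M := fun p y =>
    ⟨a p y.1 y.2.1 y.2.2, haM p y.1 y.2.1 y.2.2⟩
  have hF : Function.Injective F := by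
    intro p q hpq
    have haa : a p = a q := by
      funext x i j
      exact congrArg Subtype.val (congrFun hpq ⟨x, i, j⟩)
    have hagree : ∀ (l : ℕ) (φ : L.Formula (Fin m ⊕ Fin l)) (c : Fin l → C),
        (∀ᶠ d in extend (D p), φ.Realize (Sum.elim d c)) ↔
          ∀ᶠ d in extend (D q), φ.Realize (Sum.elim d c) := by
      intro l φ c
      rw [← ha p ⟨l, φ⟩ c, ← ha q ⟨l, φ⟩ c, haa]
    refine Subtype.ext (TypesOver.ext fun ψ => ?_)
    rw [(hb p).inType_iff, (hb q).inType_iff]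
    simp only [realize_constantsVars]
    exact eventually_congr_of_agree hagree _ _
  have hι : #ι ≤ cardT L := by
    refine (mk_sigma _).le.trans ((sum_le_sum _ (fun _ => ℵ₀) fun x => ?_).trans ?_)
    · exact (lt_aleph0_of_finite _).le
    · rw [sum_const]
      have h : #(Σ l : ℕ, L.Formula (Fin m ⊕ Fin l)) * ℵ₀ ≤ cardT L :=
        mul_le_of_le (le_max_left _ _) (mk_sigma_formula_le L m) (le_max_left _ _)
      simpa using h
  -- Monotonicity of the power in the exponent requires a nonzero base.
  have := nonempty_of_elementarySubstructure M
  refine (mk_le_of_injective hF).trans ?_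
  rw [mk_arrow]
  exact power_le_power_left (by simp) (lift_le.2 hι)

end Main

end NIPTypes

theorem mainTheorem2 {L : FirstOrder.Language.{u, v}} {T : L.Theory} {C : Type w} [L.Structure C]
    [Nonempty C] {κ : Cardinal.{w}} (hC : IsMonsterModel T C κ) (hNIP : HasNIP L C)
    (M : L.ElementarySubstructure C) (hM : #M < κ) (m : ℕ) :
    (∀ p : TypesOver L (M : Set C) m, IsStableType p →
      ∃ X : Set (Ceq L C), IsCbOfType p X ∧
        ∀ (l : ℕ) (φ : L.Formula (Fin m ⊕ Fin l)),
          (Set.univ : Set M).Definable L (restrictSet p φ) ∧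
          ∃ Y : Set (Fin l → Ceq L C), X.Definable (Leq L C) Y ∧
            ∀ c : Fin l → (M : Set C), c ∈ restrictSet p φ ↔ (fun j => Ceq.real (c j : C)) ∈ Y) ∧
    #{p : TypesOver L (M : Set C) m // IsStableType p} ≤
      Cardinal.lift.{max u v} #M ^ Cardinal.lift.{w} (cardT L) := by
  have hκ : ℵ₀ ≤ κ := by
    have h : Cardinal.lift.{w} ℵ₀ ≤ Cardinal.lift.{max u v} κ :=
      (Cardinal.lift_le.2 (le_max_left ℵ₀ L.card)).trans hC.card_lt.le
    simpa using h
  refine ⟨fun p hp => ?_, mk_stableTypes_le hC.saturated hκ hNIP M hM⟩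
  obtain ⟨D, I, _, b, hb, h⟩ := hC.saturated.exists_isStableAverage hκ (M := (M : Set C)) hM hp
  have hbM := isMorley_extend_iff.2 hb.indisc
  have := hb.infinite
  refine ⟨Cb L b, hb.isCbOfType hNIP h, fun l φ => ⟨?_, ?_⟩⟩
  · obtain ⟨δ, hδ⟩ := h.exists_definition hNIP φ
    exact definable_univ_of_formula M δ fun c => (hb.mem_restrictSet_iff φ c).trans (hδ _).symm
  · obtain ⟨k, hk⟩ := h.exists_isAvNumber hNIP hbM φ
    let t : Fin k ↪ I := Fin.valEmbedding.trans (Infinite.natEmbedding I)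
    obtain ⟨Y, hY, hYφ⟩ := exists_definable_majority φ k (fun i => b (t i)) (X := Cb L b)
      (Set.Definable.singleton_of_mem _ ⟨l, φ, k, t, h.isAveraging hNIP hbM φ, hk, rfl⟩)
    refine ⟨Y, hY, fun c => ?_⟩
    rw [hb.mem_restrictSet_iff, ← hYφ, h.majority_iff_of_isAvNumber hNIP hbM hk]
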